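/- **Notation.** Let $\mathcal P_k$ be the set of partitions $\alpha=(\alpha_1\ge\dots\ge\alpha_k\ge0)$ with $\alpha_i\in\mathbb N$, and $S(\alpha)=\sum_i\alpha_i$. Finite multisets of $k$ real numbers are identified with non-increasing sequences $\lambda=(\lambda_1\ge\dots\ge\lambda_k)$; $\sqcup$ denotes union with multiplicities, $S_c(\lambda)=\lambda_1+\dots+\lambda_c$, and $\lambda\le\lambda'$ means $S_c(\lambda)\le S_c(\lambda')$ for $c=1,\dots,k$. Let $n,m\in\mathbb N$ and $I=(\{1,\dots,n\}\times\{0\})\cup(\{1,\dots,m\}\times\{1\})$, with a total order $<_I$ such that $(i,0)<_I(j,0)\iff i<j$ and $(i,1)<_I(j,1)\iff i<j$. Let $\alpha\in\mathcal P_n$, $\beta\in\mathcal P_m$, and let $N\ge n$, $M\ge m$ be integers and $A,B,s$ reals with $s>0$, $A\ge s(N-1)$, $B\ge s(M-1)$. **The set $P_{A,B;s}(\alpha,\beta)\subset\mathcal P_n\times\mathcal P_m$** is defined, for all reals $A,B$, by induction on $n+m$. If $n=0$ or $m=0$ it is $\{(\alpha,\beta)\}$. If $n,m\ge1$ it is the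 union of the sets given by the allowed procedures among (a) and (b). (a) is allowed iff [$(1,0)<_I(1,1)$ and $\alpha_1+A\ge B$] or [$(1,1)<_I(1,0)$ and $\beta_1+B\le A$]. Put $a_1=1$, let $b_1$ be the least $j$ with $(a_1,0)<_I(j,1)$, $a_2$ the least $i$ with $(b_1,1)<_I(i,0)$, $b_2$ the least $j$ with $(a_2,0)<_I(j,1)$, and so on as long as possible; put $\nu_1=\alpha_{a_1}+\beta_{b_1}+\alpha_{a_2}+\cdots$. Let $\alpha'\in\mathcal P_{n'}$, $\beta'\in\mathcal P_{m'}$ be obtained from $\alpha,\beta$ by deleting the terms used, with the induced order on the remaining indices. The procedure gives all pairs $(\{\nu_1\}\sqcup\nu'\sqcup\{0^{n-n'-1}\},\ \mu'\sqcup\{0^{m-m'}\})$ with $(\nu',\mu')\in P_{A-s,B;s}(\alpha',\beta')$. (b) is allowed iff [$(1,0)<_I(1,1)$ and $\alpha_1+A\le B$] or [$(1,1)<_I(1,0)$ and $\beta_1+B\ge A$]. Put $b_1=1$, let $a_1$ be the least $i$ with $(b_1,1)<_I(i,0)$, $b_2$ the least $j$ with $(a_1,0)<_I(j,1)$, and so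 on; put $\mu_1=\beta_{b_1}+\alpha_{a_1}+\beta_{b_2}+\cdots$, and define $\alpha'\in\mathcal P_{n'},\beta'\in\mathcal P_{m'}$ by deleting the terms used. The procedure gives all pairs $(\nu'\sqcup\{0^{n-n'}\},\ \{\mu_1\}\sqcup\mu'\sqcup\{0^{m-m'-1}\})$ with $(\nu',\mu')\in P_{A,B-s;s}(\alpha',\beta')$. **The sequences.** For $(\nu,\mu)\in\mathcal P_n\times\mathcal P_m$, with $\nu_i=0$ for $i>n$ and $\mu_j=0$ for $j>m$, let $p\Lambda^{N,M}_{A,B;s}(\nu,\mu)$ be the multiset of the $N+M$ numbers $\nu_i+A-s(i-1)$ $(1\le i\le N)$ and $\mu_j+B-s(j-1)$ $(1\le j\le M)$. Let $p^{N,M}_{A,B;s}[\alpha,\beta]$ be $p\Lambda^{N,M}_{A,B;s}(\nu^0,\mu^0)$ for any $(\nu^0,\mu^0)\in P_{A,B;s}(\alpha,\beta)$ (this set is never empty). **The multiplicity.** Let $J$ be the set of pairs $(p,q)\in I\times I$ with $p<_Iq$ whose second components differ (one is $0$, the other $1$). For $x\in\mathbb N^J$, with $x_{p,q}=0$ if $(p,q)\notin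 J$, put $$\alpha[x]_i=\alpha_i+\sum_{j}x_{(i,0),(j,1)}-\sum_{j}x_{(j,1),(i,0)},\qquad \beta[x]_j=\beta_j+\sum_{i}x_{(j,1),(i,0)}-\sum_{i}x_{(i,0),(j,1)}.$$ For $(\nu,\mu)\in\mathbb Z^n\times\mathbb Z^m$ let $X(\alpha,\beta;\nu,\mu)$ be the (finite) set of $x\in\mathbb N^J$ with $\alpha[x]=\nu$, $\beta[x]=\mu$. For $w\in\mathfrak S_n$ put $\nu[w]_i=\nu_{w(i)}+i-w(i)$, and similarly $\mu[v]$ for $v\in\mathfrak S_m$. For $(\nu,\mu)\in\mathcal P_n\times\mathcal P_m$ put $$\mathrm{mult}(\alpha,\beta;\nu,\mu)=\sum_{w\in\mathfrak S_n,\,v\in\mathfrak S_m}\mathrm{sgn}(w)\,\mathrm{sgn}(v)\,\bigl|X(\alpha,\beta;\nu[w],\mu[v])\bigr|\in\mathbb Z.$$ **Proposition.** The multiset $p^{N,M}_{A,B;s}[\alpha,\beta]$ does not depend on the choice of the element $(\nu^0,\mu^0)$ of $P_{A,B;s}(\alpha,\beta)$. Moreover, let $(\nu,\mu)\in\mathcal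 P_n\times\mathcal P_m$ with $S(\nu)+S(\mu)=S(\alpha)+S(\beta)$. (i) If $\mathrm{mult}(\alpha,\beta;\nu,\mu)\ne0$, then $p\Lambda^{N,M}_{A,B;s}(\nu,\mu)\le p^{N,M}_{A,B;s}[\alpha,\beta]$. (ii) If $p\Lambda^{N,M}_{A,B;s}(\nu,\mu)=p^{N,M}_{A,B;s}[\alpha,\beta]$, then $\mathrm{mult}(\alpha,\beta;\nu,\mu)\ne0$ if and only if $(\nu,\mu)\in P_{A,B;s}(\alpha,\beta)$. (iii) If $(\nu,\mu)\in P_{A,B;s}(\alpha,\beta)$, then $\mathrm{mult}(\alpha,\beta;\nu,\mu)=1$. -/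

import Mathlib

/-- The index set `I = ({1,…,n} × {0}) ∪ ({1,…,m} × {1})` (with `Fin n`, `Fin m` counted from 0):
`a i` is the index `(i, 0)` and `b j` is the index `(j, 1)`. -/
inductive Idx (n m : ℕ) : Type
  | a (i : Fin n) : Idx n m
  | b (j : Fin m) : Idx n m

namespace Idx

variable {n m : ℕ}

/-- The index set as a disjoint sum. -/
def equivSum (n m : ℕ) : Fin n ⊕ Fin m ≃ Idx n m where
  toFun := Sum.elim a b
  invFun
    | a i => Sum.inl i
    | b j => Sum.inr j
  left_inv := by rintro (i | j) <;> rfl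
  right_inv := by rintro (i | j) <;> rfl

instance : Fintype (Idx n m) := Fintype.ofEquiv _ (equivSum n m)

/-- The type of an index: `true` for `(i, 0)`, `false` for `(j, 1)`. -/
def kind : Idx n m → Bool
  | a _ => true
  | b _ => false

/-- The term of the pair `(α, β)` at an index: `α_i` at `(i, 0)` and `β_j` at `(j, 1)`. -/
def val (α : Fin n → ℕ) (β : Fin m → ℕ) : Idx n m → ℕ
  | a i => α i
  | b j => β j

/-! Below, a list `L` stands for the set of the indices that have not been used yet, written in
increasing order for `<_I`.  The pair of partitions `(α', β')` extracted from `(α, β)` by these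
indices, together with the induced order, is thus encoded by `L`. -/

/-- The number of entries of type `e` in `L`. -/
def cnt (e : Bool) (L : List (Idx n m)) : ℕ := L.countP (fun x => x.kind == e)

/-- The extracted partition of type `e`, as a multiset: `α'` for `e = true`, `β'` for `e = false`. -/
def part (α : Fin n → ℕ) (β : Fin m → ℕ) (e : Bool) (L : List (Idx n m)) : Multiset ℕ :=
  ((L.filter (fun x => x.kind == e)).map (val α β) : List ℕ)

/-- The alternating chain started in type `e`: the least index of type `e`, then the least index of
the other type that is larger than it, then the least index of type `e` that is larger than the
latter, and so on as long as possible.  (`L` is listed in increasing order, so "the least index that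
is larger" is the first one met when reading on.) With `e = true` this is
`(a₁,0) < (b₁,1) < (a₂,0) < …`, with `e = false` it is `(b₁,1) < (a₁,0) < (b₂,1) < …`. -/
def chain : Bool → List (Idx n m) → List (Idx n m)
  | _, [] => []
  | e, x :: L => if x.kind = e then x :: chain (!e) L else chain e L

/-- The indices of `L` that do not belong to `chain e L`. -/
def rest : Bool → List (Idx n m) → List (Idx n m)
  | _, [] => []
  | e, x :: L => if x.kind = e then rest (!e) L else x :: rest e L

/-- The sum of the terms of `(α, β)` along `chain e L`: the new term `ν₁` for `e = true`, `μ₁` for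
`e = false`. -/
def chainSum (α : Fin n → ℕ) (β : Fin m → ℕ) (e : Bool) (L : List (Idx n m)) : ℕ :=
  ((chain e L).map (val α β)).sum

/-- Procedure (a) is allowed: the least index is `(1,0)` and `α₁ + A ≥ B`, or the least index is
`(1,1)` and `β₁ + B ≤ A`. -/
def AllowA (α : Fin n → ℕ) (β : Fin m → ℕ) (A B : ℝ) : List (Idx n m) → Prop
  | [] => False
  | x :: _ => (x.kind = true ∧ (val α β x : ℝ) + A ≥ B) ∨
      (x.kind = false ∧ (val α β x : ℝ) + B ≤ A)

/-- Procedure (b) is allowed: the least index is `(1,0)` and `α₁ + A ≤ B`, or the least index is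
`(1,1)` and `β₁ + B ≥ A`. -/
def AllowB (α : Fin n → ℕ) (β : Fin m → ℕ) (A B : ℝ) : List (Idx n m) → Prop
  | [] => False
  | x :: _ => (x.kind = true ∧ (val α β x : ℝ) + A ≤ B) ∨
      (x.kind = false ∧ (val α β x : ℝ) + B ≥ A)

/-- `InP α β s A B L ν μ`: the pair `(ν, μ)`, given by multisets of natural numbers, belongs to
`P_{A,B;s}(α', β')`, where `(α', β')` is the pair extracted from `(α, β)` by the indices in `L`. -/
inductive InP (α : Fin n → ℕ) (β : Fin m → ℕ) (s : ℝ) :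
    ℝ → ℝ → List (Idx n m) → Multiset ℕ → Multiset ℕ → Prop
  | base (A B : ℝ) (L : List (Idx n m)) (h : cnt true L = 0 ∨ cnt false L = 0) :
      InP α β s A B L (part α β true L) (part α β false L)
  | stepA (A B : ℝ) (L : List (Idx n m)) (ν' μ' : Multiset ℕ)
      (ha : 1 ≤ cnt true L) (hb : 1 ≤ cnt false L) (h : AllowA α β A B L)
      (h' : InP α β s (A - s) B (rest true L) ν' μ') :
      InP α β s A B L
        ({chainSum α β true L} + ν' +
          Multiset.replicate (cnt true L - cnt true (rest true L) - 1) 0)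
        (μ' + Multiset.replicate (cnt false L - cnt false (rest true L)) 0)
  | stepB (A B : ℝ) (L : List (Idx n m)) (ν' μ' : Multiset ℕ)
      (ha : 1 ≤ cnt true L) (hb : 1 ≤ cnt false L) (h : AllowB α β A B L)
      (h' : InP α β s A (B - s) (rest false L) ν' μ') :
      InP α β s A B L
        (ν' + Multiset.replicate (cnt true L - cnt true (rest false L)) 0)
        ({chainSum α β false L} + μ' +
          Multiset.replicate (cnt false L - cnt false (rest false L) - 1) 0)

/-! Existence of elements. -/

theorem rest_cnt (f e : Bool) (L : List (Idx n m)) :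
    cnt f (rest e L) + cnt f (chain e L) = cnt f L := by
  induction L generalizing e with
  | nil => simp [rest, chain, cnt]
  | cons x L ih =>
    by_cases hx : x.kind = e
    · have := ih (!e)
      simp only [rest, chain, hx, if_true, cnt, List.countP_cons] at this ⊢
      omega
    · have := ih e
      simp only [rest, chain, hx, if_false, cnt, List.countP_cons] at this ⊢
      omega

theorem chain_cnt_pos (e : Bool) (L : List (Idx n m)) (h : 1 ≤ cnt e L) :
    1 ≤ cnt e (chain e L) := by
  induction L with
  | nil => simp [cnt] at h
  | cons x L ih =>
    by_cases hx : x.kind = e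
    · simp [chain, hx, cnt]
    · simp only [chain, hx, if_false]
      apply ih
      simpa [cnt, List.countP_cons, hx] using h

theorem InP.card_eq {α : Fin n → ℕ} {β : Fin m → ℕ} {s A B : ℝ} {L : List (Idx n m)}
    {ν μ : Multiset ℕ} (h : InP α β s A B L ν μ) : ν.card = cnt true L ∧ μ.card = cnt false L := by
  induction h with
  | base A B L h => simp [part, cnt, List.countP_eq_length_filter]
  | stepA A B L ν' μ' ha hb h h' ih =>
    have h1 := rest_cnt true true L
    have h2 := rest_cnt false true L
    have h3 := chain_cnt_pos true L ha
    simp only [Multiset.card_add, Multiset.card_singleton, Multiset.card_replicate, ih.1, ih.2]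
    omega
  | stepB A B L ν' μ' ha hb h h' ih =>
    have h1 := rest_cnt true false L
    have h2 := rest_cnt false false L
    have h3 := chain_cnt_pos false L hb
    simp only [Multiset.card_add, Multiset.card_singleton, Multiset.card_replicate, ih.1, ih.2]
    omega

theorem allow_or (α : Fin n → ℕ) (β : Fin m → ℕ) (A B : ℝ) (L : List (Idx n m))
    (ha : 1 ≤ cnt true L) : AllowA α β A B L ∨ AllowB α β A B L := by
  cases L with
  | nil => simp [cnt] at ha
  | cons x L =>
    cases hk : x.kind
    · rcases le_total ((val α β x : ℝ) + B) A with h | h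
      · exact Or.inl (Or.inr ⟨hk, h⟩)
      · exact Or.inr (Or.inr ⟨hk, h⟩)
    · rcases le_total ((val α β x : ℝ) + A) B with h | h
      · exact Or.inr (Or.inl ⟨hk, h⟩)
      · exact Or.inl (Or.inl ⟨hk, h⟩)

theorem exists_inP (α : Fin n → ℕ) (β : Fin m → ℕ) (s : ℝ) (k : ℕ) :
    ∀ (A B : ℝ) (L : List (Idx n m)), cnt true L + cnt false L ≤ k →
      ∃ ν μ, InP α β s A B L ν μ := by
  induction k with
  | zero => exact fun A B L h => ⟨_, _, InP.base A B L (Or.inl (by omega))⟩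
  | succ k ih =>
    intro A B L h
    by_cases h0 : cnt true L = 0 ∨ cnt false L = 0
    · exact ⟨_, _, InP.base A B L h0⟩
    · have ha : 1 ≤ cnt true L := by omega
      have hb : 1 ≤ cnt false L := by omega
      rcases allow_or α β A B L ha with hA | hB
      · have h1 := rest_cnt true true L
        have h2 := rest_cnt false true L
        have h3 := chain_cnt_pos true L ha
        obtain ⟨ν', μ', h'⟩ := ih (A - s) B (rest true L) (by omega)
        exact ⟨_, _, InP.stepA A B L ν' μ' ha hb hA h'⟩
      · have h1 := rest_cnt true false L
        have h2 := rest_cnt false false L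
        have h3 := chain_cnt_pos false L hb
        obtain ⟨ν', μ', h'⟩ := ih A (B - s) (rest false L) (by omega)
        exact ⟨_, _, InP.stepB A B L ν' μ' ha hb hB h'⟩

end Idx

section Main

variable {n m : ℕ}

/-- The multiset of the terms of a finite sequence. -/
def terms {R : Type} {k : ℕ} (ν : Fin k → R) : Multiset R := Multiset.map ν Finset.univ.val

/-- The set `P_{A,B;s}(α, β)` of pairs of partitions, relative to the total order `<_I` on the index
set.  Partitions in `𝒫_n` are antitone functions `Fin n → ℕ`. -/
def PairSet [LinearOrder (Idx n m)] (A B s : ℝ) (α : Fin n → ℕ) (β : Fin m → ℕ) :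
    Set ((Fin n → ℕ) × (Fin m → ℕ)) :=
  {p | Antitone p.1 ∧ Antitone p.2 ∧
    Idx.InP α β s A B (Finset.univ : Finset (Idx n m)).sort (terms p.1) (terms p.2)}

/-- The sequence `(ν ⊔ {0^{N-n}}) + [A, A + s - sN]_s`. -/
def symbolRow (N : ℕ) (A s : ℝ) {k : ℕ} (ν : Fin k → ℕ) (i : Fin N) : ℝ :=
  (if h : (i : ℕ) < k then (ν ⟨i, h⟩ : ℝ) else 0) + (A - s * (i : ℕ))

/-- `pΛ^{N,M}_{A,B;s}(ν, μ)`, as a finite multiset of real numbers. -/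
def pLambda (N M : ℕ) (A B s : ℝ) (ν : Fin n → ℕ) (μ : Fin m → ℕ) : Multiset ℝ :=
  terms (symbolRow N A s ν) + terms (symbolRow M B s μ)

/-- `S_k(λ)`: the sum of the `k` largest terms of `λ`. -/
noncomputable def partialSum (k : ℕ) (l : Multiset ℝ) : ℝ :=
  ((l.sort (fun x y => y ≤ x)).take k).sum

/-- The order `λ ≤ λ'` on finite multisets of real numbers with the same number of terms. -/
def DomLE (l l' : Multiset ℝ) : Prop :=
  l.card = l'.card ∧ ∀ k : ℕ, 1 ≤ k → k ≤ l.card → partialSum k l ≤ partialSum k l'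

theorem exists_antitone_terms (k : ℕ) (S : Multiset ℕ) (h : S.card = k) :
    ∃ ν : Fin k → ℕ, Antitone ν ∧ terms ν = S := by
  subst h
  have hl : (S.sort (fun x y => y ≤ x)).length = S.card := Multiset.length_sort _
  refine ⟨fun i => (S.sort (fun x y => y ≤ x)).get (i.cast hl.symm), ?_, ?_⟩
  · intro i j hij
    have hs := Multiset.pairwise_sort S (fun x y : ℕ => y ≤ x)
    rcases hij.lt_or_eq with hlt | rfl
    · exact List.pairwise_iff_get.1 hs (i.cast hl.symm) (j.cast hl.symm) hlt
    · exact le_rfl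
  · have h1 : ∀ (l : List ℕ) (c : ℕ) (hc : c = l.length),
        terms (fun i : Fin c => l.get (i.cast hc)) = (l : Multiset ℕ) := by
      rintro l _ rfl
      simp [terms, Fin.univ_val_map]
    rw [h1 _ _ hl.symm, Multiset.sort_eq]

theorem Idx.cnt_sort_univ [LinearOrder (Idx n m)] :
    Idx.cnt true (Finset.univ : Finset (Idx n m)).sort = n ∧
      Idx.cnt false (Finset.univ : Finset (Idx n m)).sort = m := by
  have key : ∀ e : Bool, Idx.cnt e (Finset.univ : Finset (Idx n m)).sort =
      ∑ x : Idx n m, if x.kind = e then 1 else 0 := by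
    intro e
    have h := Multiset.coe_countP (fun x : Idx n m => x.kind = e)
      (Finset.univ : Finset (Idx n m)).sort
    rw [Finset.sort_eq, Multiset.countP_eq_card_filter] at h
    rw [← Finset.card_filter, Idx.cnt, Finset.card_def, Finset.filter_val, h]
    congr
  constructor <;>
  · rw [key, ← (Idx.equivSum n m).sum_comp, Fintype.sum_sum_type]
    simp [Idx.equivSum, Idx.kind]

theorem PairSet_nonempty [LinearOrder (Idx n m)] (A B s : ℝ) (α : Fin n → ℕ) (β : Fin m → ℕ) :
    (PairSet A B s α β).Nonempty := by
  obtain ⟨ν, μ, h⟩ := Idx.exists_inP α β s _ A B (Finset.univ : Finset (Idx n m)).sort le_rfl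
  obtain ⟨ν', hν, rfl⟩ := exists_antitone_terms n ν (h.card_eq.1.trans Idx.cnt_sort_univ.1)
  obtain ⟨μ', hμ, rfl⟩ := exists_antitone_terms m μ (h.card_eq.2.trans Idx.cnt_sort_univ.2)
  exact ⟨(ν', μ'), hν, hμ, h⟩

/-- `p^{N,M}_{A,B;s}[α, β]`: the multiset `pΛ^{N,M}_{A,B;s}(ν, μ)` for an arbitrarily chosen element
`(ν, μ)` of `P_{A,B;s}(α, β)`. -/
noncomputable def pMax [LinearOrder (Idx n m)] (N M : ℕ) (A B s : ℝ)
    (α : Fin n → ℕ) (β : Fin m → ℕ) : Multiset ℝ :=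
  pLambda N M A B s (PairSet_nonempty A B s α β).some.1 (PairSet_nonempty A B s α β).some.2

/-- `J`: the pairs of indices of different types, the first smaller than the second. -/
def JSet (n m : ℕ) [LinearOrder (Idx n m)] : Type :=
  {p : Idx n m × Idx n m // p.1 < p.2 ∧ p.1.kind ≠ p.2.kind}

/-- The coordinate `x_{p,q}` of `x ∈ ℕ^J`, extended by `0` to the pairs `(p, q)` outside `J`. -/
def coord [LinearOrder (Idx n m)] (x : JSet n m → ℕ) (p q : Idx n m) : ℤ :=
  if h : p < q ∧ p.kind ≠ q.kind then (x ⟨(p, q), h⟩ : ℤ) else 0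

/-- `α[x]`. -/
def twistA [LinearOrder (Idx n m)] (α : Fin n → ℕ) (x : JSet n m → ℕ) (i : Fin n) : ℤ :=
  α i + ∑ j : Fin m, coord x (Idx.a i) (Idx.b j) - ∑ j : Fin m, coord x (Idx.b j) (Idx.a i)

/-- `β[x]`. -/
def twistB [LinearOrder (Idx n m)] (β : Fin m → ℕ) (x : JSet n m → ℕ) (j : Fin m) : ℤ :=
  β j + ∑ i : Fin n, coord x (Idx.b j) (Idx.a i) - ∑ i : Fin n, coord x (Idx.a i) (Idx.b j)

/-- `X(α, β; ν, μ)` (a finite set). -/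
def XSet [LinearOrder (Idx n m)] (α : Fin n → ℕ) (β : Fin m → ℕ) (ν : Fin n → ℤ) (μ : Fin m → ℤ) :
    Set (JSet n m → ℕ) :=
  {x | twistA α x = ν ∧ twistB β x = μ}

/-- `ν[w]`, with `ν[w]_i = ν_{w i} + i - w i`. -/
def shiftPerm {k : ℕ} (ν : Fin k → ℕ) (w : Equiv.Perm (Fin k)) (i : Fin k) : ℤ :=
  ν (w i) + ((i : ℕ) : ℤ) - ((w i : ℕ) : ℤ)

/-- `mult(α, β; ν, μ)`. -/
noncomputable def pairMult [LinearOrder (Idx n m)] (α : Fin n → ℕ) (β : Fin m → ℕ)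
    (ν : Fin n → ℕ) (μ : Fin m → ℕ) : ℤ :=
  ∑ w : Equiv.Perm (Fin n), ∑ v : Equiv.Perm (Fin m),
    (Equiv.Perm.sign w : ℤ) * (Equiv.Perm.sign v : ℤ) *
      ((XSet α β (shiftPerm ν w) (shiftPerm μ v)).ncard : ℤ)

end Main

/-!
The index set with its order and the pair `(α, β)` are encoded by a word in letters of two kinds.
With `(ν, μ)` written as zero-padded sequences, `mult` satisfies a recursion (`wordMult`) on that
word.  If the first letter has kind `0` and value `x`, expand the alternating sum over `w` along the
first row: the new row `ν_j - j` (counting from `0`) exceeds `x` by the total amount `t` taken from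
the letters of the other kind, and by Pieri's rule, which is a sign-reversing exchange of
neighbouring rows (`sum_comps_eq_sum_filter`), only horizontal strips `μ'/μ` of size `t` survive the
alternating sum over `v` (`pairMult_eq_wordMult`).

Let `greedy e f` be the total of the letters collected by `e` chains starting with kind `0` and `f`
chains starting with kind `1`, all of them alternating and taking every letter they can.  In a strip
the size `t` together with the first `f` parts of `μ` is at most the sum of the first `f + 1` parts
of `μ'`, which is exactly the recursion of `greedy`; hence every pair that occurs satisfies
`ν_1 + ⋯ + ν_e + μ_1 + ⋯ + μ_f ≤ greedy e f` (`sum_add_sum_le_greedy`).  If `ν_1` attains the bound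
`greedy 1 0`, only one strip can contribute for each letter of the chain, and the multiplicity is
that of the remaining pair in the word without its greedy chain (`wordMult_prepend_left`).  This is
what procedure (a) does, so that pairs in `P(α, β)` have multiplicity one (`wordMult_of_inP`).

The inequality that allows procedure (a) says `greedy 0 1 + B ≤ greedy 1 0 + A`, and then
`greedy e f` plus the constants of the `e + f` leading terms is, by induction, at most the sum of
the `e + f` largest terms of the symbol of any pair in `P(α, β)` (`greedy_le_partialSum`).  So these
symbols dominate the symbols of all pairs that occur, and in particular they coincide.  Conversely,
if the symbol of a pair that occurs is the maximal one, its largest term is `greedy 1 0 + A` or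
`greedy 0 1 + B`, which shows that the corresponding procedure is allowed and reduces to a shorter
word (`inP_of_symbol_eq`).
-/

namespace KindWord

/-! ### Words with letters of two kinds -/

/-- A word: the values of `α` and `β` listed in the order of `<_I`, each tagged with its kind
(`true` for a term of `α`, `false` for a term of `β`). -/
abbrev Word := List (Bool × ℕ)

/-- Exchange the two kinds. -/
def flip (W : Word) : Word := W.map fun p => (!p.1, p.2)

@[simp] theorem flip_nil : flip [] = [] := rfl

@[simp] theorem flip_cons (e : Bool) (x : ℕ) (W : Word) :
    flip ((e, x) :: W) = (!e, x) :: flip W := rfl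

@[simp] theorem flip_flip (W : Word) : flip (flip W) = W := by
  induction W with
  | nil => rfl
  | cons p W ih => obtain ⟨e, x⟩ := p; simp [ih]

/-- Each of the two sequences interleaved in the word is non-increasing. -/
def KindAntitone (W : Word) : Prop := W.Pairwise fun p q => p.1 = q.1 → q.2 ≤ p.2

theorem KindAntitone.tail {p : Bool × ℕ} {W : Word} (h : KindAntitone (p :: W)) :
    KindAntitone W := (List.pairwise_cons.1 h).2

theorem KindAntitone.le_head {e : Bool} {x : ℕ} {W : Word} (h : KindAntitone ((e, x) :: W)) :
    ∀ q ∈ W, q.1 = e → q.2 ≤ x := fun q hq hqe => (List.pairwise_cons.1 h).1 q hq hqe.symm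

theorem KindAntitone.flip {W : Word} (h : KindAntitone W) : KindAntitone (flip W) := by
  unfold KindAntitone KindWord.flip
  rw [List.pairwise_map]
  exact h.imp fun {p q} hpq e => hpq (by simpa using e)

/-- The number of letters of a given kind. -/
def count (e : Bool) (W : Word) : ℕ := W.countP fun p => p.1 == e

@[simp] theorem count_nil (e : Bool) : count e [] = 0 := rfl

@[simp] theorem count_cons (e e' : Bool) (x : ℕ) (W : Word) :
    count e ((e', x) :: W) = count e W + if e' = e then 1 else 0 := by
  simp [count, List.countP_cons]

@[simp] theorem count_flip (e : Bool) (W : Word) : count e (flip W) = count (!e) W := by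
  induction W with
  | nil => rfl
  | cons p W ih => obtain ⟨e', x⟩ := p; cases e <;> cases e' <;> simp [ih]

/-- What remains of a word when the greedy alternating chain starting with kind `e` is removed. -/
def unchained : Bool → Word → Word
  | _, [] => []
  | e, (e', x) :: W => if e' = e then unchained (!e) W else (e', x) :: unchained e W

theorem unchained_flip (e : Bool) (W : Word) :
    unchained e (flip W) = flip (unchained (!e) W) := by
  induction W generalizing e with
  | nil => rfl
  | cons p W ih =>
    obtain ⟨e', x⟩ := p
    cases e <;> cases e' <;> simp [unchained, ih]

theorem unchained_sublist (e : Bool) (W : Word) : (unchained e W).Sublist W := by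
  induction W generalizing e with
  | nil => simp [unchained]
  | cons p W ih =>
    obtain ⟨e', x⟩ := p
    by_cases h : e' = e
    · simpa [unchained, h] using (ih (!e)).cons (e, x)
    · simpa [unchained, h] using ih e

theorem KindAntitone.unchained {W : Word} (h : KindAntitone W) (e : Bool) :
    KindAntitone (unchained e W) := h.sublist (unchained_sublist e W)

/-! ### Greedy sums of several chains -/

/-- The total value collected when a word is read from left to right by `e + f` agents, `e` of
which wait for a letter of kind `true` and `f` for one of kind `false`; each letter is taken by an
agent waiting for it, if there is one, and this agent then waits for the other kind. -/
def greedy : Word → ℕ → ℕ → ℕ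
  | [], _, _ => 0
  | (true, _) :: W, 0, f => greedy W 0 f
  | (true, x) :: W, e + 1, f => x + greedy W e (f + 1)
  | (false, _) :: W, e, 0 => greedy W e 0
  | (false, x) :: W, e, f + 1 => x + greedy W (e + 1) f

@[simp] theorem greedy_nil (e f : ℕ) : greedy [] e f = 0 := by simp [greedy]
@[simp] theorem greedy_true_zero (x : ℕ) (W : Word) (f : ℕ) :
    greedy ((true, x) :: W) 0 f = greedy W 0 f := by simp [greedy]
@[simp] theorem greedy_true_succ (x : ℕ) (W : Word) (e f : ℕ) :
    greedy ((true, x) :: W) (e + 1) f = x + greedy W e (f + 1) := by simp [greedy]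
@[simp] theorem greedy_false_zero (x : ℕ) (W : Word) (e : ℕ) :
    greedy ((false, x) :: W) e 0 = greedy W e 0 := by simp [greedy]
@[simp] theorem greedy_false_succ (x : ℕ) (W : Word) (e f : ℕ) :
    greedy ((false, x) :: W) e (f + 1) = x + greedy W (e + 1) f := by simp [greedy]
@[simp] theorem greedy_true_one (x : ℕ) (W : Word) (f : ℕ) :
    greedy ((true, x) :: W) 1 f = x + greedy W 0 (f + 1) := greedy_true_succ x W 0 f
@[simp] theorem greedy_false_one (x : ℕ) (W : Word) (e : ℕ) :
    greedy ((false, x) :: W) e 1 = x + greedy W (e + 1) 0 := greedy_false_succ x W e 0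

theorem greedy_flip (W : Word) (e f : ℕ) : greedy (flip W) e f = greedy W f e := by
  induction W generalizing e f with
  | nil => simp
  | cons p W ih =>
    obtain ⟨k, x⟩ := p
    cases k
    · cases e <;> simp [ih]
    · cases f <;> simp [ih]

/-- Turning one agent around costs at most the value of one letter: the two runs coincide from the
moment the agent in question takes a letter in one run only. -/
theorem greedy_succ_left_le {W : Word} {X : ℕ} (h : ∀ q ∈ W, q.1 = true → q.2 ≤ X) (e f : ℕ) :
    greedy W (e + 1) f ≤ X + greedy W e (f + 1) := by
  induction W generalizing e f with
  | nil => simp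
  | cons p W ih =>
    have ih := ih fun q hq => h q (List.mem_cons_of_mem _ hq)
    obtain ⟨k, x⟩ := p
    cases k
    · cases f with
      | zero => simp; omega
      | succ f =>
        have := ih (e + 1) f
        simp only [greedy_false_succ]
        omega
    · have hx : x ≤ X := h (true, x) (by simp) rfl
      cases e with
      | zero => simpa using hx
      | succ e =>
        have := ih e (f + 1)
        simp only [greedy_true_succ]
        omega

theorem greedy_succ_right_le {W : Word} {X : ℕ} (h : ∀ q ∈ W, q.1 = false → q.2 ≤ X) (e f : ℕ) :
    greedy W e (f + 1) ≤ X + greedy W (e + 1) f := by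
  rw [← greedy_flip W, ← greedy_flip W]
  refine greedy_succ_left_le (fun q hq hk => ?_) f e
  obtain ⟨p, hp, rfl⟩ := List.mem_map.1 hq
  exact h p hp (by simpa using hk)

/-- Let one agent take precedence over all others: it runs through the greedy chain, and the others
read what remains. -/
theorem greedy_eq_add_unchained (W : Word) (e f : ℕ) :
    greedy W (e + 1) f = greedy W 1 0 + greedy (unchained true W) e f ∧
      greedy W e (f + 1) = greedy W 0 1 + greedy (unchained false W) e f := by
  induction W generalizing e f with
  | nil => simp [unchained]
  | cons p W ih =>
    obtain ⟨k, x⟩ := p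
    cases k
    · refine ⟨?_, ?_⟩
      · cases f with
        | zero => simpa [unchained] using (ih e 0).1
        | succ f => simp [unchained, (ih (e + 1) f).1, add_left_comm]
      · simp [unchained, (ih e f).1, add_assoc]
    · refine ⟨?_, ?_⟩
      · simp [unchained, (ih e f).2, add_assoc]
      · cases e with
        | zero => simpa [unchained] using (ih 0 f).2
        | succ e => simp [unchained, (ih e (f + 1)).2, add_left_comm]

theorem greedy_succ_left (W : Word) (e f : ℕ) :
    greedy W (e + 1) f = greedy W 1 0 + greedy (unchained true W) e f :=
  (greedy_eq_add_unchained W e f).1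

theorem greedy_succ_right (W : Word) (e f : ℕ) :
    greedy W e (f + 1) = greedy W 0 1 + greedy (unchained false W) e f :=
  (greedy_eq_add_unchained W e f).2

theorem greedy_unchained_le {W : Word} (hW : KindAntitone W) :
    greedy (unchained true W) 1 0 ≤ greedy W 1 0 ∧
      greedy (unchained false W) 0 1 ≤ greedy W 0 1 := by
  induction W with
  | nil => simp [unchained]
  | cons p W ih =>
    have ih := ih hW.tail
    obtain ⟨k, x⟩ := p
    have hx := hW.le_head
    cases k
    · have h := greedy_succ_right_le (W := unchained true W) (X := x)
        (fun q hq => hx q ((unchained_sublist _ _).subset hq)) 0 0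
      simp only [zero_add] at h
      simp [unchained]
      omega
    · have h := greedy_succ_left_le (W := unchained false W) (X := x)
        (fun q hq => hx q ((unchained_sublist _ _).subset hq)) 0 0
      simp only [zero_add] at h
      simp [unchained]
      omega

/-! ### A recursion for multiplicities -/

/-- The sequence `(d, ν₀, ν₁, …)`. -/
def prepend (d : ℕ) (ν : ℕ → ℕ) : ℕ → ℕ
  | 0 => d
  | i + 1 => ν i

@[simp] theorem prepend_zero (d : ℕ) (ν : ℕ → ℕ) : prepend d ν 0 = d := rfl
@[simp] theorem prepend_succ (d : ℕ) (ν : ℕ → ℕ) (i : ℕ) : prepend d ν (i + 1) = ν i := rfl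

theorem prepend_injective (d : ℕ) : Function.Injective (prepend d) :=
  fun _ _ h => funext fun i => congrFun h (i + 1)

theorem sum_prepend (d : ℕ) (ν : ℕ → ℕ) (k : ℕ) :
    ∑ i ∈ Finset.range (k + 1), prepend d ν i = d + ∑ i ∈ Finset.range k, ν i := by
  rw [Finset.sum_range_succ', add_comm]; rfl

theorem antitone_prepend {d : ℕ} {ν : ℕ → ℕ} (hν : Antitone ν) (h : ν 0 ≤ d) :
    Antitone (prepend d ν) := by
  refine antitone_nat_of_succ_le fun i => ?_
  cases i with
  | zero => exact h
  | succ i => exact hν i.le_succ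

/-- `ν` without its part of index `j`, the parts before it being raised by one; in terms of the
strictly decreasing sequence `ν i - i`, one term is deleted. -/
def delPart (ν : ℕ → ℕ) (j : ℕ) : ℕ → ℕ := fun i => if i < j then ν i + 1 else ν (i + 1)

theorem antitone_delPart {ν : ℕ → ℕ} (hν : Antitone ν) (j : ℕ) : Antitone (delPart ν j) := by
  refine antitone_nat_of_succ_le fun i => ?_
  unfold delPart
  have h1 : ν (i + 1) ≤ ν i := hν i.le_succ
  have h2 : ν (i + 1 + 1) ≤ ν (i + 1) := hν (i + 1).le_succ
  split_ifs <;> omega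

@[simp] theorem delPart_prepend_zero (d : ℕ) (ν : ℕ → ℕ) : delPart (prepend d ν) 0 = ν := by
  funext i; simp [delPart]

/-- `μ'/μ` is a horizontal strip. -/
def Strip (μ μ' : ℕ → ℕ) : Prop := (∀ i, μ i ≤ μ' i) ∧ ∀ i, μ' (i + 1) ≤ μ i

theorem Strip.antitone {μ μ' : ℕ → ℕ} (h : Strip μ μ') : Antitone μ' :=
  antitone_nat_of_succ_le fun i => (h.2 i).trans (h.1 i)

/-- The skew diagram `μ'/μ` has size `ν j - j - x`.  Sizes of sequences are compared through their
long partial sums, so that no subtraction and no finiteness assumption is needed. -/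
def SizeEq (x j : ℕ) (ν μ μ' : ℕ → ℕ) : Prop :=
  ∃ K₀, ∀ K, K₀ ≤ K →
    x + j + ∑ i ∈ Finset.range K, μ' i = ν j + ∑ i ∈ Finset.range K, μ i

open Classical in
/-- The effect on multiplicities `F` of prefixing a word by a letter of value `x`, the first
argument being the partition of the kind of that letter.  The sum is over the pairs `(j, μ')`. -/
noncomputable def prefixLetter (x : ℕ) (F : (ℕ → ℕ) → (ℕ → ℕ) → ℤ) (ν μ : ℕ → ℕ) : ℤ :=
  ∑ᶠ p : ℕ × (ℕ → ℕ),
    if Strip μ p.2 ∧ SizeEq x p.1 ν μ p.2 then (-1) ^ p.1 * F (delPart ν p.1) p.2 else 0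

open Classical in
/-- The multiplicity of `(ν, μ)` in a word, by recursion on the word.  For a first letter of kind
`true`, the index `j` comes from the Laplace expansion of the alternating sum over `w` along the
first row, and `μ'` from Pieri's rule for the amounts moved to that row.  Partitions are zero-padded
sequences, so that the definition does not refer to the numbers `n`, `m` of their parts. -/
noncomputable def wordMult : Word → (ℕ → ℕ) → (ℕ → ℕ) → ℤ
  | [], ν, μ => if ν = 0 ∧ μ = 0 then 1 else 0
  | (true, x) :: W, ν, μ => prefixLetter x (wordMult W) ν μ
  | (false, x) :: W, ν, μ => prefixLetter x (fun μ ν => wordMult W ν μ) μ ν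

theorem wordMult_flip (W : Word) (ν μ : ℕ → ℕ) : wordMult (flip W) ν μ = wordMult W μ ν := by
  induction W generalizing ν μ with
  | nil =>
    simp only [flip_nil, wordMult]
    congr 1
    exact propext and_comm
  | cons p W ih =>
    obtain ⟨k, x⟩ := p
    have h : wordMult (flip W) = fun ν μ => wordMult W μ ν := by
      funext ν μ
      exact ih ν μ
    cases k <;> simp only [flip_cons, wordMult, h, Bool.not_true, Bool.not_false]

theorem exists_of_prefixLetter_ne_zero {x : ℕ} {F : (ℕ → ℕ) → (ℕ → ℕ) → ℤ} {ν μ : ℕ → ℕ}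
    (h : prefixLetter x F ν μ ≠ 0) :
    ∃ j μ', Strip μ μ' ∧ SizeEq x j ν μ μ' ∧ F (delPart ν j) μ' ≠ 0 := by
  by_contra! hc
  refine h ?_
  unfold prefixLetter
  refine (finsum_congr fun p => ?_).trans finsum_zero
  split_ifs with hp
  · simp [hc p.1 p.2 hp.1 hp.2]
  · rfl

/-- To prove a statement about words that is invariant under the exchange of the kinds, only a first
letter of kind `true` has to be considered. -/
theorem flip_induction {P : Word → Prop} (hflip : ∀ W, P W → P (flip W)) (nil : P [])
    (cons : ∀ x W, P W → P ((true, x) :: W)) (W : Word) : P W := by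
  induction W with
  | nil => exact nil
  | cons p W ih =>
    obtain ⟨k, x⟩ := p
    cases k
    · simpa using hflip _ (cons x _ (hflip _ ih))
    · exact cons x W ih

/-- A pair that occurs in a word has no more parts of a kind than there are letters of that kind. -/
theorem wordMult_support (W : Word) : ∀ ν μ, wordMult W ν μ ≠ 0 →
    (∀ i, count true W ≤ i → ν i = 0) ∧ ∀ i, count false W ≤ i → μ i = 0 := by
  refine flip_induction (P := fun W => ∀ ν μ, wordMult W ν μ ≠ 0 →
    (∀ i, count true W ≤ i → ν i = 0) ∧ ∀ i, count false W ≤ i → μ i = 0) ?_ ?_ ?_ W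
  · intro W ih ν μ h
    simpa using (ih μ ν (by rwa [wordMult_flip] at h)).symm
  · intro ν μ h
    simp only [wordMult, ne_eq, ite_eq_right_iff, one_ne_zero, imp_false, not_not] at h
    simp [h.1, h.2]
  · intro x W ih ν μ h
    obtain ⟨j, μ', hs, -, hF⟩ := exists_of_prefixLetter_ne_zero h
    obtain ⟨h1, h2⟩ := ih _ _ hF
    simp only [count_cons, if_true, Bool.true_eq_false, if_false, add_zero]
    refine ⟨fun i hi => ?_, fun i hi => Nat.le_zero.1 ((hs.1 i).trans (h2 i hi).le)⟩
    have hj : j ≤ count true W := by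
      by_contra! hj
      simpa [delPart, hj] using h1 _ le_rfl
    obtain ⟨i, rfl⟩ : ∃ i', i = i' + 1 := ⟨i - 1, by omega⟩
    simpa [delPart, show ¬ i < j by omega] using h1 i (by omega)

/-- The size of a strip together with the first `f` parts of `μ` is at most the sum of the first
`f + 1` parts of `μ'`, because each later part of `μ'` is at most the preceding part of `μ`. -/
theorem SizeEq.add_sum_le {x j : ℕ} {ν μ μ' : ℕ → ℕ} (h : SizeEq x j ν μ μ') (hs : Strip μ μ')
    (f : ℕ) : ν j + ∑ i ∈ Finset.range f, μ i ≤ x + j + ∑ i ∈ Finset.range (f + 1), μ' i := by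
  obtain ⟨K, hK⟩ := h
  have h1 := hK (K + f + 1) (by omega)
  rw [show K + f + 1 = f + 1 + K by ring, Finset.sum_range_add,
    show f + 1 + K = f + (K + 1) by ring, Finset.sum_range_add _ f (K + 1)] at h1
  have h2 : ∑ i ∈ Finset.range K, μ' (f + 1 + i) ≤ ∑ i ∈ Finset.range (K + 1), μ (f + i) := by
    rw [Finset.sum_range_succ]
    refine le_add_right (Finset.sum_le_sum fun i _ => ?_)
    rw [show f + 1 + i = f + i + 1 by ring]
    exact hs.2 _
  omega

theorem sum_delPart_of_le (ν : ℕ → ℕ) {e j : ℕ} (h : e ≤ j) :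
    ∑ i ∈ Finset.range e, delPart ν j i = ∑ i ∈ Finset.range e, ν i + e := by
  rw [Finset.sum_congr rfl (g := fun i => ν i + 1), Finset.sum_add_distrib]
  · simp
  · intro i hi
    rw [Finset.mem_range] at hi
    simp [delPart, show i < j by omega]

theorem sum_delPart_of_ge (ν : ℕ → ℕ) {e j : ℕ} (h : j ≤ e) :
    ∑ i ∈ Finset.range e, delPart ν j i + ν j = ∑ i ∈ Finset.range (e + 1), ν i + j := by
  induction e, h using Nat.le_induction with
  | base => rw [sum_delPart_of_le ν le_rfl, Finset.sum_range_succ]; ring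
  | succ e he ih =>
    rw [Finset.sum_range_succ, Finset.sum_range_succ _ (e + 1)]
    simp only [delPart, show ¬ e < j by omega, if_false] at ih ⊢
    omega

/-- The partial sums of a pair that occurs in a word are bounded by the greedy sums. -/
theorem sum_add_sum_le_greedy (W : Word) : KindAntitone W → ∀ ν μ, wordMult W ν μ ≠ 0 → ∀ e f,
    ∑ i ∈ Finset.range e, ν i + ∑ i ∈ Finset.range f, μ i ≤ greedy W e f := by
  refine flip_induction (P := fun W => KindAntitone W → ∀ ν μ, wordMult W ν μ ≠ 0 → ∀ e f,
    ∑ i ∈ Finset.range e, ν i + ∑ i ∈ Finset.range f, μ i ≤ greedy W e f) ?_ ?_ ?_ W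
  · intro W ih hW ν μ h e f
    rw [greedy_flip, add_comm]
    exact ih (by simpa using hW.flip) μ ν (by rwa [wordMult_flip] at h) f e
  · intro _ ν μ h e f
    simp only [wordMult, ne_eq, ite_eq_right_iff, one_ne_zero, imp_false, not_not] at h
    simp [h.1, h.2]
  · intro x W ih hW ν μ h e f
    obtain ⟨j, μ', hs, hz, hF⟩ := exists_of_prefixLetter_ne_zero h
    have ih := ih hW.tail _ _ hF
    rcases le_or_gt e j with hej | hej
    · have h1 := ih e f
      rw [sum_delPart_of_le ν hej] at h1
      have h2 : ∑ i ∈ Finset.range f, μ i ≤ ∑ i ∈ Finset.range f, μ' i :=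
        Finset.sum_le_sum fun i _ => hs.1 i
      cases e with
      | zero => simp at h1 ⊢; omega
      | succ e =>
        have h3 := greedy_succ_left_le hW.le_head e f
        simp only [greedy_true_succ]
        omega
    · obtain ⟨e, rfl⟩ : ∃ e', e = e' + 1 := ⟨e - 1, by omega⟩
      have h1 := ih e (f + 1)
      have h2 := sum_delPart_of_ge ν (show j ≤ e by omega)
      have h3 := hz.add_sum_le hs f
      simp only [greedy_true_succ]
      omega

/-! ### Extremal components -/

/-- A strip of maximal size whose first part is bounded by that size moves everything: `μ'` is `μ`
with one new part in front. -/
theorem Strip.eq_prepend {x d : ℕ} {ν μ μ' : ℕ → ℕ} (hs : Strip μ μ')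
    (hz : SizeEq x 0 (prepend (x + d) ν) μ μ') (hd : μ' 0 ≤ d) : μ' = prepend d μ := by
  obtain ⟨K₀, hK⟩ := hz
  have key : ∀ k, ∑ i ∈ Finset.range (K₀ + k), μ' (i + 1) ≤ ∑ i ∈ Finset.range (K₀ + k), μ i :=
    fun k => Finset.sum_le_sum fun i _ => hs.2 i
  have heq : ∀ k, μ' 0 = d ∧
      ∑ i ∈ Finset.range (K₀ + k), μ' (i + 1) = ∑ i ∈ Finset.range (K₀ + k), μ i := by
    intro k
    have h1 := hK (K₀ + k + 1) (by omega)
    rw [Finset.sum_range_succ', Finset.sum_range_succ] at h1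
    have h2 := key k
    simp only [prepend_zero] at h1
    omega
  funext i
  cases i with
  | zero => exact (heq 0).1
  | succ i =>
    exact (Finset.sum_eq_sum_iff_of_le fun i _ => hs.2 i).1 (heq (i + 1)).2 i
      (Finset.mem_range.2 (by omega))

/-- If the first letter has kind `true`, a pair whose first part equals the greedy bound comes only
from the term where the whole first part of the other partition is moved to the new row. -/
theorem wordMult_true_cons_prepend {x : ℕ} {W : Word} (hW : KindAntitone ((true, x) :: W))
    (ih : ∀ ν μ, Antitone ν → Antitone μ →
      wordMult W ν (prepend (greedy W 0 1) μ) = wordMult (unchained false W) ν μ)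
    {ν μ : ℕ → ℕ} (hν : Antitone ν) (hμ : Antitone μ) :
    wordMult ((true, x) :: W) (prepend (greedy ((true, x) :: W) 1 0) ν) μ =
      wordMult (unchained true ((true, x) :: W)) ν μ := by
  have hb := sum_add_sum_le_greedy W hW.tail
  have hu : unchained true ((true, x) :: W) = unchained false W := by simp [unchained]
  rw [hu, ← ih ν μ hν hμ, greedy_true_one, zero_add]
  simp only [wordMult, prefixLetter]
  set d := greedy W 0 1 with hd
  rw [finsum_eq_single _ (0, prepend d μ)]
  · simp only [pow_zero, one_mul, delPart_prepend_zero]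
    split_ifs with hc
    · rfl
    · symm
      by_contra h0
      refine hc ⟨?_, ?_⟩
      · have h1 : μ 0 ≤ d := by
          rw [ih ν μ hν hμ] at h0
          have h2 := sum_add_sum_le_greedy _ (hW.tail.unchained false) _ _ h0 0 1
          have h3 := (greedy_unchained_le hW.tail).2
          simp at h2
          omega
        exact ⟨fun i => antitone_prepend hμ h1 i.le_succ, fun i => le_rfl⟩
      · refine ⟨count false W, fun K hK => ?_⟩
        have h1 := (wordMult_support W _ _ h0).2 (K + 1) (by omega)
        have h2 : μ K = 0 := h1
        rw [← Nat.add_zero (∑ i ∈ Finset.range K, μ i), ← h2, ← Finset.sum_range_succ]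
        cases K with
        | zero =>
          have h3 : d = 0 := (wordMult_support W _ _ h0).2 0 hK
          simp [h2, h3]
        | succ K =>
          have h3 : μ K = 0 := (wordMult_support W _ _ h0).2 (K + 1) hK
          rw [sum_prepend, Finset.sum_range_succ, Finset.sum_range_succ, h2, h3, prepend_zero]
          ring
  · rintro ⟨j, μ'⟩ hne
    split_ifs with hc
    · obtain ⟨hs, hz⟩ := hc
      by_contra h0
      have h0 := right_ne_zero_of_mul h0
      have hb := hb _ _ h0
      dsimp only at *
      rcases Nat.eq_zero_or_pos j with rfl | hj
      · refine hne ?_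
        rw [hs.eq_prepend hz (by simpa using hb 0 1)]
      · have h1 := hb 1 0
        have h2 := greedy_succ_left_le hW.le_head 0 0
        simp [delPart, hj] at h1 h2
        omega
    · rfl

theorem strip_prepend_iff {d : ℕ} {ν ν' : ℕ → ℕ} :
    Strip (prepend d ν) (prepend d ν') ↔ Strip ν ν' ∧ ν' 0 ≤ d := by
  constructor
  · intro h
    exact ⟨⟨fun i => h.1 (i + 1), fun i => h.2 (i + 1)⟩, h.2 0⟩
  · rintro ⟨h, h0⟩
    refine ⟨fun i => ?_, fun i => ?_⟩
    · cases i with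
      | zero => rfl
      | succ i => exact h.1 i
    · cases i with
      | zero => exact h0
      | succ i => exact h.2 i

theorem sizeEq_prepend_iff {x j d : ℕ} {μ ν ν' : ℕ → ℕ} :
    SizeEq x j μ (prepend d ν) (prepend d ν') ↔ SizeEq x j μ ν ν' := by
  constructor
  · rintro ⟨K₀, h⟩
    refine ⟨K₀, fun K hK => ?_⟩
    have := h (K + 1) (by omega)
    rw [sum_prepend, sum_prepend] at this
    omega
  · rintro ⟨K₀, h⟩
    refine ⟨K₀ + 1, fun K hK => ?_⟩
    obtain ⟨K, rfl⟩ : ∃ K', K = K' + 1 := ⟨K - 1, by omega⟩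
    have := h K (by omega)
    rw [sum_prepend, sum_prepend]
    omega

/-- If the first letter has kind `false`, it does not act on a first part of the other kind that
equals the greedy bound. -/
theorem wordMult_false_cons_prepend {x : ℕ} {W : Word} (hW : KindAntitone ((false, x) :: W))
    (ih : ∀ ν μ, Antitone ν → Antitone μ →
      wordMult W (prepend (greedy W 1 0) ν) μ = wordMult (unchained true W) ν μ)
    {ν μ : ℕ → ℕ} (hμ : Antitone μ) :
    wordMult ((false, x) :: W) (prepend (greedy ((false, x) :: W) 1 0) ν) μ =
      wordMult (unchained true ((false, x) :: W)) ν μ := by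
  have hb := sum_add_sum_le_greedy W hW.tail
  have hu : unchained true ((false, x) :: W) = (false, x) :: unchained true W := by
    simp [unchained]
  rw [hu, greedy_false_zero]
  simp only [wordMult, prefixLetter]
  set d := greedy W 1 0 with hd
  have hinj : Function.Injective fun p : ℕ × (ℕ → ℕ) => (p.1, prepend d p.2) := by
    rintro ⟨j, ν₁⟩ ⟨j', ν₂⟩ h
    simp only [Prod.mk.injEq] at h ⊢
    exact ⟨h.1, prepend_injective d h.2⟩
  -- the first row cannot grow, so only pairs `(j, prepend d ν')` contribute
  rw [← finsum_mem_univ, ← finsum_mem_inter_support_eq' (s := Set.range fun p : ℕ × (ℕ → ℕ) =>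
    (p.1, prepend d p.2)), finsum_mem_range hinj]
  · refine finsum_congr fun ⟨j, ν'⟩ => ?_
    dsimp only
    rw [strip_prepend_iff, sizeEq_prepend_iff]
    by_cases hs : Strip ν ν'
    · rw [ih ν' _ hs.antitone (antitone_delPart hμ j)]
      by_cases h0 : wordMult (unchained true W) ν' (delPart μ j) = 0
      · simp [h0]
      · have h1 := sum_add_sum_le_greedy _ (hW.tail.unchained true) _ _ h0 1 0
        have h2 := (greedy_unchained_le hW.tail).1
        have h3 : ν' 0 ≤ d := by simp at h1; omega
        have h4 : (Strip ν ν' ∧ ν' 0 ≤ d) = Strip ν ν' := by simp [h3]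
        rw [h4]
    · simp [hs]
  · rintro ⟨j, ν'⟩ hp
    simp only [Function.mem_support, ne_eq, ite_eq_right_iff, Classical.not_imp] at hp
    obtain ⟨⟨hs, -⟩, h0⟩ := hp
    have h1 := hb _ _ (right_ne_zero_of_mul h0) 1 0
    have h2 := hs.1 0
    simp only [Finset.sum_range_one, Finset.sum_range_zero, add_zero, prepend_zero] at h1 h2
    refine iff_of_true ⟨(j, fun i => ν' (i + 1)), ?_⟩ trivial
    simp only [Prod.mk.injEq, true_and]
    funext i
    cases i with
    | zero => exact (h2.antisymm h1)
    | succ i => rfl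

/-- Pairs whose first part equals the greedy bound `greedy W 1 0` have the multiplicity that the
remaining pair has in the word without its greedy chain. -/
theorem wordMult_prepend_left {W : Word} (hW : KindAntitone W) {ν μ : ℕ → ℕ} (hν : Antitone ν)
    (hμ : Antitone μ) :
    wordMult W (prepend (greedy W 1 0) ν) μ = wordMult (unchained true W) ν μ := by
  suffices h : ∀ W, KindAntitone W →
      (∀ ν μ, Antitone ν → Antitone μ →
        wordMult W (prepend (greedy W 1 0) ν) μ = wordMult (unchained true W) ν μ) ∧
      (∀ ν μ, Antitone ν → Antitone μ →
        wordMult W ν (prepend (greedy W 0 1) μ) = wordMult (unchained false W) ν μ) from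
    (h W hW).1 ν μ hν hμ
  intro W
  refine flip_induction (P := fun W => KindAntitone W →
      (∀ ν μ, Antitone ν → Antitone μ →
        wordMult W (prepend (greedy W 1 0) ν) μ = wordMult (unchained true W) ν μ) ∧
      (∀ ν μ, Antitone ν → Antitone μ →
        wordMult W ν (prepend (greedy W 0 1) μ) = wordMult (unchained false W) ν μ)) ?_ ?_ ?_ W
  · intro W ih hW
    have ih := ih (by simpa using hW.flip)
    refine ⟨fun ν μ hν hμ => ?_, fun ν μ hν hμ => ?_⟩
    · rw [wordMult_flip, greedy_flip, unchained_flip, wordMult_flip]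
      exact ih.2 μ ν hμ hν
    · rw [wordMult_flip, greedy_flip, unchained_flip, wordMult_flip]
      exact ih.1 μ ν hμ hν
  · intro _
    have h : ∀ ν : ℕ → ℕ, prepend 0 ν = 0 ↔ ν = 0 := fun ν =>
      ⟨fun h => funext fun i => congrFun h (i + 1), by
        rintro rfl; funext i; cases i <;> rfl⟩
    refine ⟨fun ν μ _ _ => ?_, fun ν μ _ _ => ?_⟩
    · simp only [unchained, wordMult]
      congr 1
      rw [greedy_nil, h]
    · simp only [unchained, wordMult]
      congr 1
      rw [greedy_nil, h]
  · intro x W ih hW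
    have ih := ih hW.tail
    refine ⟨fun ν μ hν hμ => wordMult_true_cons_prepend hW ih.2 hν hμ, fun ν μ hν hμ => ?_⟩
    have h := wordMult_false_cons_prepend (W := flip W) (x := x) (by simpa using hW.flip)
      (fun ν μ hν hμ => by
        rw [wordMult_flip, greedy_flip, unchained_flip, wordMult_flip]
        exact ih.2 μ ν hμ hν) (ν := μ) (μ := ν) hν
    rw [show (false, x) :: flip W = flip ((true, x) :: W) from rfl, wordMult_flip, greedy_flip,
      unchained_flip, wordMult_flip] at h
    exact h

theorem wordMult_prepend_right {W : Word} (hW : KindAntitone W) {ν μ : ℕ → ℕ} (hν : Antitone ν)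
    (hμ : Antitone μ) :
    wordMult W ν (prepend (greedy W 0 1) μ) = wordMult (unchained false W) ν μ := by
  have h := wordMult_prepend_left hW.flip hμ hν
  rwa [wordMult_flip, greedy_flip, unchained_flip, wordMult_flip] at h

/-! ### Counting flows -/

/-- The sequences of `m` natural numbers with sum `t`; there are none for negative `t`. -/
def comps (m : ℕ) (t : ℤ) : Finset (Fin m → ℕ) :=
  if 0 ≤ t then Finset.piAntidiag Finset.univ t.toNat else ∅

theorem mem_comps {m : ℕ} {t : ℤ} {y : Fin m → ℕ} : y ∈ comps m t ↔ ∑ i, (y i : ℤ) = t := by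
  unfold comps
  have h0 : (0 : ℤ) ≤ ∑ i, (y i : ℤ) := Finset.sum_nonneg fun i _ => by positivity
  split_ifs with ht
  · rw [Finset.mem_piAntidiag]
    have h : ((Finset.univ.sum y : ℕ) : ℤ) = ∑ i, (y i : ℤ) := Nat.cast_sum _ _
    simp only [Finset.mem_univ, implies_true, and_true]
    rw [← h]
    generalize Finset.univ.sum y = a
    omega
  · simp only [Finset.notMem_empty, false_iff]
    intro h
    omega

/-- The number of flows `x` (see `IsFlow`) on a word that turn the values of its letters into `κ`
on the letters of kind `true` and into `l` on the letters of kind `false`, computed letter by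
letter.  It is `0` if the lengths of `κ` and `l` do not fit. -/
def rawCount : Word → (n m : ℕ) → (Fin n → ℤ) → (Fin m → ℤ) → ℤ
  | [], n, m, _, _ => if n = 0 ∧ m = 0 then 1 else 0
  | (true, _) :: _, 0, _, _, _ => 0
  | (true, x) :: W, n + 1, m, κ, l =>
      ∑ y ∈ comps m (κ 0 - x), rawCount W n m (fun i => κ i.succ) (fun j => l j + y j)
  | (false, _) :: _, _, 0, _, _ => 0
  | (false, x) :: W, n, m + 1, κ, l =>
      ∑ y ∈ comps n (l 0 - x), rawCount W n m (fun i => κ i + y i) (fun j => l j.succ)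

theorem rawCount_flip (W : Word) : ∀ (n m : ℕ) (κ : Fin n → ℤ) (l : Fin m → ℤ),
    rawCount (flip W) m n l κ = rawCount W n m κ l := by
  induction W with
  | nil => intro n m κ l; simp [rawCount, and_comm]
  | cons p W ih =>
    intro n m κ l
    obtain ⟨k, x⟩ := p
    cases k
    · cases m with
      | zero => simp [rawCount]
      | succ m => simp [rawCount, ih]
    · cases n with
      | zero => simp [rawCount]
      | succ n => simp [rawCount, ih]

/-- `p` occurs before `q` in the list (which will have no repetitions). -/
def Before {ι : Type*} : List ι → ι → ι → Prop
  | [], _, _ => False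
  | a :: S, p, q => (p = a ∧ q ∈ S) ∨ Before S p q

theorem Before.mem {ι : Type*} {S : List ι} {p q : ι} (h : Before S p q) : p ∈ S ∧ q ∈ S := by
  induction S with
  | nil => exact h.elim
  | cons a S ih =>
    rcases h with ⟨rfl, hq⟩ | h
    · simp [hq]
    · exact ⟨List.mem_cons_of_mem _ (ih h).1, List.mem_cons_of_mem _ (ih h).2⟩

/-- The matrix `x`, supported on the pairs of letters of `S` of different kinds in increasing order,
turns the values `val` of the letters of `S` into `κ`. -/
def IsFlow {ι : Type*} [Fintype ι] (kind : ι → Bool) (val : ι → ℕ) (S : List ι) (κ : ι → ℤ) (x : ι → ι → ℕ) : Prop :=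
  (∀ p q, x p q ≠ 0 → Before S p q ∧ kind p ≠ kind q) ∧
    ∀ p ∈ S, (val p : ℤ) + ∑ q, (x p q : ℤ) - ∑ q, (x q p : ℤ) = κ p

theorem isFlow_not {ι : Type*} [Fintype ι] (kind : ι → Bool) (val : ι → ℕ) (S : List ι) (κ : ι → ℤ) (x : ι → ι → ℕ) :
    IsFlow (fun p => !kind p) val S κ x ↔ IsFlow kind val S κ x := by
  simp [IsFlow]

theorem sum_extend {ι : Type*} [Fintype ι] {m : ℕ} {e : Fin m → ι} (he : Function.Injective e) (z : Fin m → ℕ) :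
    ∑ q, ((Function.extend e z 0 q : ℕ) : ℤ) = ∑ j, (z j : ℤ) := by
  symm
  refine Fintype.sum_of_injective e he _ _ (fun q hq => ?_) fun j => ?_
  · rw [Function.extend_apply' _ _ _ (by simpa using hq)]; rfl
  · rw [he.extend_apply]

/-- Splitting off the row of the first letter of a flow. -/
noncomputable def flowEquiv {ι : Type*} [Fintype ι] [DecidableEq ι] {kind : ι → Bool} {val : ι → ℕ} {S : List ι} {p₀ : ι} (hp₀ : p₀ ∉ S)
    (hk : kind p₀ = true) {m : ℕ} {e : Fin m → ι} (he : Function.Injective e)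
    (hm : ∀ q, q ∈ S ∧ kind q = false ↔ ∃ j, e j = q) (κ : ι → ℤ) :
    {x // IsFlow kind val (p₀ :: S) κ x} ≃
      Σ z : comps m (κ p₀ - val p₀),
        {x // IsFlow kind val S (fun p => κ p + (Function.extend e z.1 0 p : ℕ)) x} := by
  have hcol : ∀ x, IsFlow kind val (p₀ :: S) κ x → ∀ q, x q p₀ = 0 := by
    intro x hx q
    by_contra h
    rcases (hx.1 q p₀ h).1 with h | h
    · exact hp₀ h.2
    · exact hp₀ h.mem.2
  have hrow : ∀ x, IsFlow kind val (p₀ :: S) κ x →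
      Function.extend e (fun j => x p₀ (e j)) 0 = x p₀ := by
    intro x hx
    funext q
    by_cases hq : ∃ j, e j = q
    · obtain ⟨j, rfl⟩ := hq
      rw [he.extend_apply]
    · rw [Function.extend_apply' _ _ _ hq]
      by_contra h
      obtain ⟨h1, h2⟩ := hx.1 p₀ q (Ne.symm h)
      refine hq ((hm q).1 ⟨?_, by simpa [hk] using h2⟩)
      rcases h1 with h1 | h1
      · exact h1.2
      · exact h1.mem.2
  have hcol' : ∀ κ' x, IsFlow kind val S κ' x → ∀ q, x p₀ q = 0 ∧ x q p₀ = 0 := by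
    intro κ' x hx q
    refine ⟨?_, ?_⟩ <;> by_contra h
    · exact hp₀ (hx.1 _ _ h).1.mem.1
    · exact hp₀ (hx.1 _ _ h).1.mem.2
  have hext : ∀ (z : Fin m → ℕ) (q : ι), Function.extend e z 0 q ≠ 0 → q ∈ S ∧ kind q = false := by
    intro z q h
    by_contra hq
    rw [hm] at hq
    exact h (Function.extend_apply' _ _ _ hq)
  have hsum : ∀ (x : ι → ι → ℕ) (r : ι → ℕ) (p : ι), x p₀ p = 0 →
      ∑ q, ((Function.update x p₀ r q p : ℕ) : ℤ) = r p + ∑ q, (x q p : ℤ) := by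
    intro x r p h
    rw [← Finset.add_sum_erase _ _ (Finset.mem_univ p₀),
      ← Finset.add_sum_erase _ (fun q => (x q p : ℤ)) (Finset.mem_univ p₀), h]
    simp only [Function.update_self, Nat.cast_zero, zero_add]
    congr 1
    refine Finset.sum_congr rfl fun q hq => ?_
    rw [Function.update_of_ne (Finset.ne_of_mem_erase hq)]
  refine
    { toFun := fun x => ⟨⟨fun j => x.1 p₀ (e j), ?_⟩, ⟨Function.update x.1 p₀ 0, ?_, ?_⟩⟩
      invFun := fun z => ⟨Function.update z.2.1 p₀ (Function.extend e z.1.1 0), ?_, ?_⟩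
      left_inv := ?_
      right_inv := ?_ }
  · rw [mem_comps, ← sum_extend he, hrow x.1 x.2]
    have h := x.2.2 p₀ (by simp)
    simp only [hcol x.1 x.2, Nat.cast_zero, Finset.sum_const_zero, sub_zero] at h
    omega
  · intro p q h
    by_cases hp : p = p₀
    · subst hp; simp at h
    · rw [Function.update_of_ne hp] at h
      obtain ⟨h1, h2⟩ := x.2.1 p q h
      exact ⟨h1.resolve_left fun h => hp h.1, h2⟩
  · intro p hp
    have hne : p ≠ p₀ := fun h => hp₀ (h ▸ hp)
    have h := x.2.2 p (List.mem_cons_of_mem _ hp)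
    have h1 := hsum (Function.update x.1 p₀ 0) (x.1 p₀) p (by simp)
    rw [Function.update_idem, Function.update_eq_self] at h1
    rw [Function.update_of_ne hne]
    dsimp only
    rw [hrow x.1 x.2]
    omega
  · intro p q h
    by_cases hp : p = p₀
    · subst hp
      rw [Function.update_self] at h
      obtain ⟨h1, h2⟩ := hext _ _ h
      exact ⟨Or.inl ⟨rfl, h1⟩, by simp [hk, h2]⟩
    · rw [Function.update_of_ne hp] at h
      obtain ⟨h1, h2⟩ := z.2.2.1 p q h
      exact ⟨Or.inr h1, h2⟩
  · intro p hp
    have hc := hcol' _ _ z.2.2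
    rw [hsum _ _ _ (hc p).1]
    rcases eq_or_ne p p₀ with rfl | hne
    · have h1 := mem_comps.1 z.1.2
      rw [Function.update_self, sum_extend he, h1]
      have h2 : Function.extend e z.1.1 0 p = 0 := by
        by_contra h
        exact hp₀ (hext _ _ h).1
      simp [h2, fun q => (hc q).2]
    · have h := z.2.2.2 p ((List.mem_cons.1 hp).resolve_left hne)
      rw [Function.update_of_ne hne]
      dsimp only at h
      omega
  · rintro ⟨x, hx⟩
    refine Subtype.ext ?_
    dsimp only
    rw [Function.update_idem, hrow x hx, Function.update_eq_self]
  · rintro ⟨⟨z, hz⟩, ⟨x, hx⟩⟩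
    have h1 : (fun j => Function.update x p₀ (Function.extend e z 0) p₀ (e j)) = z := by
      funext j
      rw [Function.update_self, he.extend_apply]
    have h2 : Function.update (Function.update x p₀ (Function.extend e z 0)) p₀ 0 = x := by
      rw [Function.update_idem]
      funext p q
      by_cases hp : p = p₀
      · subst hp; simp [(hcol' _ _ hx q).1]
      · rw [Function.update_of_ne hp]
    dsimp only
    exact Sigma.subtype_ext (Subtype.ext h1) h2

/-- The word of a list of letters. -/
def wordOf {ι : Type*} (kind : ι → Bool) (val : ι → ℕ) (S : List ι) : Word := S.map fun p => (kind p, val p)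

/-- The number of flows on a list `S` without repetitions is `rawCount` of its word, `e` and `e'`
being the increasing enumerations of the letters of the two kinds. -/
theorem card_isFlow {ι : Type*} [Fintype ι] [DecidableEq ι] (val : ι → ℕ) (S : List ι) (hS : S.Nodup) :
    ∀ (kind : ι → Bool) (κ : ι → ℤ) (n m : ℕ) (e : Fin n → ι) (e' : Fin m → ι),
      S.filter (fun p => kind p) = List.ofFn e → S.filter (fun p => !kind p) = List.ofFn e' →
      Finite {x // IsFlow kind val S κ x} ∧
        (Nat.card {x // IsFlow kind val S κ x} : ℤ) =
          rawCount (wordOf kind val S) n m (κ ∘ e) (κ ∘ e') := by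
  induction S with
  | nil =>
    intro kind κ n m e e' he he'
    have hn : n = 0 := by simpa using (congrArg List.length he).symm
    have hm : m = 0 := by simpa using (congrArg List.length he').symm
    have : Unique {x // IsFlow kind val [] κ x} :=
      { default := ⟨0, by simp [IsFlow]⟩
        uniq := by
          rintro ⟨x, hx⟩
          refine Subtype.ext (funext fun p => funext fun q => ?_)
          by_contra h
          exact (hx.1 p q h).1 }
    refine ⟨inferInstance, ?_⟩
    rw [Nat.card_unique]
    simp [wordOf, rawCount, hn, hm]
  | cons p₀ S ih =>
    have hp₀ := (List.nodup_cons.1 hS).1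
    have ih := ih (List.nodup_cons.1 hS).2
    -- the statement is symmetric in the two kinds
    have key : ∀ (kind : ι → Bool) (κ : ι → ℤ) (n m : ℕ) (e : Fin n → ι) (e' : Fin m → ι),
        kind p₀ = true →
        (p₀ :: S).filter (fun p => kind p) = List.ofFn e →
        (p₀ :: S).filter (fun p => !kind p) = List.ofFn e' →
        Finite {x // IsFlow kind val (p₀ :: S) κ x} ∧
          (Nat.card {x // IsFlow kind val (p₀ :: S) κ x} : ℤ) =
            rawCount (wordOf kind val (p₀ :: S)) n m (κ ∘ e) (κ ∘ e') := by
      intro kind κ n m e e' hk he he'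
      cases n with
      | zero => simp [hk] at he
      | succ n =>
        rw [List.ofFn_succ, List.filter_cons_of_pos (by simpa using hk), List.cons.injEq] at he
        rw [List.filter_cons_of_neg (by simpa using hk)] at he'
        obtain ⟨he0, he⟩ := he
        have hinj : Function.Injective e' := by
          rw [← List.nodup_ofFn, ← he']
          exact (List.nodup_cons.1 hS).2.filter _
        have hm : ∀ q, q ∈ S ∧ kind q = false ↔ ∃ j, e' j = q := by
          intro q
          have h : q ∈ S.filter (fun p => !kind p) ↔ q ∈ List.ofFn e' := by rw [he']
          simpa [List.mem_ofFn] using h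
        have hE := flowEquiv (val := val) hp₀ hk hinj hm κ
        have hfib := fun z : comps m (κ p₀ - val p₀) =>
          ih kind (fun p => κ p + (Function.extend e' z.1 0 p : ℕ)) n m _ e' he he'
        have := fun z => (hfib z).1
        refine ⟨Finite.of_equiv _ hE.symm, ?_⟩
        rw [Nat.card_congr hE, Nat.card_sigma]
        push_cast
        rw [Finset.sum_congr rfl fun z _ => (hfib z).2]
        simp only [wordOf, List.map_cons, hk, rawCount, Function.comp_apply, ← he0]
        rw [← Finset.sum_coe_sort (comps m (κ p₀ - val p₀))]
        refine Finset.sum_congr rfl fun z _ => ?_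
        congr 1
        · funext i
          have h : ¬ ∃ j, e' j = e i.succ := by
            rw [← hm]
            have h1 : e i.succ ∈ S.filter (fun p => kind p) := by
              rw [he, List.mem_ofFn]; exact ⟨i, rfl⟩
            simp at h1
            simp [h1]
          simp only [Function.comp_apply]
          rw [Function.extend_apply' _ _ _ h]
          simp
        · funext j
          simp only [Function.comp_apply]
          rw [hinj.extend_apply]
    intro kind κ n m e e' he he'
    cases hk : kind p₀
    · have h := key (fun p => !kind p) κ m n e' e (by simp [hk]) he' (by simpa using he)
      simp only [isFlow_not] at h
      refine ⟨h.1, h.2.trans ?_⟩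
      rw [← rawCount_flip]
      simp [wordOf, flip, Function.comp_def]
    · exact key kind κ n m e e' hk he he'

/-! ### Alternating sums -/

/-- The alternating sum of flow counts over the permutations of `κ` and of `l`, which stand for the
shifted partitions `ν i - i` and `μ j - j`. -/
def altCount (W : Word) (n m : ℕ) (κ : Fin n → ℤ) (l : Fin m → ℤ) : ℤ :=
  ∑ w : Equiv.Perm (Fin n), ∑ v : Equiv.Perm (Fin m),
    (Equiv.Perm.sign w : ℤ) * (Equiv.Perm.sign v : ℤ) *
      rawCount W n m (fun i => κ (w i) + (i : ℕ)) (fun j => l (v j) + (j : ℕ))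

theorem altCount_flip (W : Word) (n m : ℕ) (κ : Fin n → ℤ) (l : Fin m → ℤ) :
    altCount (flip W) m n l κ = altCount W n m κ l := by
  unfold altCount
  rw [Finset.sum_comm]
  refine Finset.sum_congr rfl fun w _ => Finset.sum_congr rfl fun v _ => ?_
  rw [rawCount_flip, mul_comm (Equiv.Perm.sign v : ℤ)]

theorem altCount_comp_swap (W : Word) (n m : ℕ) (κ : Fin n → ℤ) (l : Fin m → ℤ) {i j : Fin m}
    (hij : i ≠ j) : altCount W n m κ (l ∘ Equiv.swap i j) = -altCount W n m κ l := by
  unfold altCount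
  rw [← Finset.sum_neg_distrib]
  refine Finset.sum_congr rfl fun w _ => ?_
  rw [← Finset.sum_neg_distrib]
  refine Fintype.sum_equiv (Equiv.mulLeft (Equiv.swap i j)) _ _ fun v => ?_
  simp [Equiv.Perm.sign_swap hij]

/-- Laplace expansion along the first row, for an arbitrary function of the permutation. -/
theorem sum_perm_fin_succ {n : ℕ} (F : (Fin (n + 1) → Fin (n + 1)) → ℤ) :
    ∑ w : Equiv.Perm (Fin (n + 1)), (Equiv.Perm.sign w : ℤ) * F w =
      ∑ j : Fin (n + 1), (-1) ^ (j : ℕ) * ∑ w : Equiv.Perm (Fin n),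
        (Equiv.Perm.sign w : ℤ) * F (Fin.cons j fun i => j.succAbove (w i)) := by
  rw [Finset.univ_perm_fin_succ, ← Finset.univ_product_univ]
  simp only [Finset.sum_map, Equiv.toEmbedding_apply, Finset.sum_product]
  refine Finset.sum_congr rfl fun j _ => ?_
  induction j using Fin.cases with
  | zero =>
    simp only [Fin.val_zero, pow_zero, one_mul, Equiv.Perm.decomposeFin.symm_sign, if_true]
    refine Finset.sum_congr rfl fun w _ => ?_
    congr 2
    funext i
    induction i using Fin.cases <;> simp
  | succ j =>
    rw [Finset.mul_sum]
    refine Fintype.sum_equiv (Equiv.mulLeft j.cycleRange) _ _ fun w => ?_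
    rw [Equiv.Perm.decomposeFin.symm_sign, if_neg (Fin.succ_ne_zero j)]
    have h : ⇑(Equiv.Perm.decomposeFin.symm (j.succ, w)) =
        Fin.cons j.succ fun i => j.succ.succAbove (Equiv.mulLeft j.cycleRange w i) := by
      funext i
      induction i using Fin.cases with
      | zero => simp
      | succ i => simp [Fin.succAbove_cycleRange]
    rw [h]
    generalize F (Fin.cons j.succ fun i =>
      j.succ.succAbove (Equiv.mulLeft j.cycleRange w i)) = a
    have h2 : ((-1 : ℤ) ^ (j : ℕ)) * (-1) ^ (j : ℕ) = 1 := by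
      rw [← mul_pow]; simp
    simp only [Equiv.coe_mulLeft, Equiv.Perm.sign_mul, Fin.sign_cycleRange, Fin.val_succ]
    push_cast
    rw [pow_succ]
    linear_combination (Equiv.Perm.sign w : ℤ) * a * h2

theorem sum_comps_comp {m : ℕ} (t : ℤ) (v : Equiv.Perm (Fin m)) (F : (Fin m → ℕ) → ℤ) :
    ∑ y ∈ comps m t, F (fun i => y (v i)) = ∑ y ∈ comps m t, F y := by
  refine Finset.sum_bij' (fun y _ => fun i => y (v i)) (fun y _ => fun i => y (v.symm i)) ?_ ?_
    ?_ ?_ ?_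
  · intro y hy
    rw [mem_comps] at hy ⊢
    rw [← hy]
    exact Equiv.sum_comp v fun i => (y i : ℤ)
  · intro y hy
    rw [mem_comps] at hy ⊢
    rw [← hy]
    exact Equiv.sum_comp v.symm fun i => (y i : ℤ)
  · intro y _; simp
  · intro y _; simp
  · intro y _; rfl

/-- Expansion along the first row; the amounts `y` taken from the other kind are permuted together
with `l`. -/
theorem altCount_true_cons (x : ℕ) (W : Word) (n m : ℕ) (κ : Fin (n + 1) → ℤ) (l : Fin m → ℤ) :
    altCount ((true, x) :: W) (n + 1) m κ l =
      ∑ j : Fin (n + 1), (-1) ^ (j : ℕ) * ∑ y ∈ comps m (κ j - x),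
        altCount W n m (fun i => κ (j.succAbove i) + 1) (fun i => l i + y i) := by
  have h := sum_perm_fin_succ (n := n) fun w => ∑ v : Equiv.Perm (Fin m),
    (Equiv.Perm.sign v : ℤ) * rawCount ((true, x) :: W) (n + 1) m
      (fun i => κ (w i) + (i : ℕ)) (fun j => l (v j) + (j : ℕ))
  simp only [Finset.mul_sum, ← mul_assoc] at h
  unfold altCount
  rw [h]
  refine Finset.sum_congr rfl fun j _ => ?_
  simp only [Finset.mul_sum, rawCount, Fin.cons_zero, Fin.cons_succ, Fin.val_zero, Nat.cast_zero,
    add_zero, Fin.val_succ]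
  rw [Finset.sum_comm' (t' := Finset.univ) (s' := fun _ => comps m (κ j - x)) (by simp)]
  refine Finset.sum_congr rfl fun w _ => ?_
  rw [Finset.sum_comm' (t' := Finset.univ) (s' := fun _ => comps m (κ j - x)) (by simp)]
  refine Finset.sum_congr rfl fun v _ => ?_
  rw [← sum_comps_comp _ v]
  refine Finset.sum_congr rfl fun y _ => ?_
  simp only [mul_assoc]
  congr 4
  · funext i; push_cast; ring
  · funext i; ring

/-! ### Pieri's rule -/

/-- The indices at which `l + y` reaches the preceding term of `l`. -/
def crossings {m : ℕ} (l : Fin m → ℤ) (y : Fin m → ℕ) : Finset (Fin m) :=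
  Finset.univ.filter fun j => ∃ i : Fin m, (i : ℕ) + 1 = j ∧ l i ≤ l j + y j

/-- Exchange the terms of index `i` and `j` of `l + y`. -/
def exchange {m : ℕ} (l : Fin m → ℤ) (i j : Fin m) (y : Fin m → ℕ) : Fin m → ℕ :=
  fun k => (l (Equiv.swap i j k) + y (Equiv.swap i j k) - l k).toNat

theorem add_exchange {m : ℕ} {l : Fin m → ℤ} {i j : Fin m} {y : Fin m → ℕ} (hij : l j ≤ l i)
    (h : l i ≤ l j + y j) :
    (fun k => l k + (exchange l i j y k : ℤ)) = (fun k => l k + (y k : ℤ)) ∘ Equiv.swap i j := by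
  funext k
  have h0 : (0 : ℤ) ≤ l (Equiv.swap i j k) + y (Equiv.swap i j k) - l k := by
    rcases eq_or_ne k i with rfl | hi
    · rw [Equiv.swap_apply_left]; omega
    · rcases eq_or_ne k j with rfl | hj
      · rw [Equiv.swap_apply_right]; omega
      · rw [Equiv.swap_apply_of_ne_of_ne hi hj]; omega
  simp only [exchange, Function.comp_apply, Int.toNat_of_nonneg h0]
  ring

/-- The terms in which `l + y` does not interlace with `l` cancel: exchange the terms of `l + y` at
the largest crossing and at its predecessor. -/
theorem sum_comps_eq_sum_filter {m : ℕ} {G : (Fin m → ℤ) → ℤ}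
    (hG : ∀ (l : Fin m → ℤ) (i j : Fin m), i ≠ j → G (l ∘ Equiv.swap i j) = -G l)
    {l : Fin m → ℤ} (hl : Antitone l) (t : ℤ) :
    ∑ y ∈ comps m t, G (fun i => l i + y i) =
      ∑ y ∈ comps m t with crossings l y = ∅, G (fun i => l i + y i) := by
  rw [← Finset.sum_filter_add_sum_filter_not _ fun y => crossings l y = ∅, add_eq_left]
  rcases isEmpty_or_nonempty (Fin m) with hm | hm
  · rw [Finset.filter_false_of_mem fun y _ => not_not.2 (Finset.eq_empty_of_isEmpty _),
      Finset.sum_empty]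
  have hmem : ∀ y ∈ (comps m t).filter (fun y => ¬ crossings l y = ∅), ∃ i j : Fin m,
      (i : ℕ) + 1 = j ∧ l i ≤ l j + y j ∧ ∀ k ∈ crossings l y, k ≤ j := by
    intro y hy
    have hne := Finset.nonempty_iff_ne_empty.2 (Finset.mem_filter.1 hy).2
    obtain ⟨i, h1, h2⟩ := (Finset.mem_filter.1 (Finset.max'_mem _ hne)).2
    exact ⟨i, _, h1, h2, fun k hk => Finset.le_max' _ _ hk⟩
  choose! I J h1 h2 h3 using hmem
  have hlt : ∀ y ∈ (comps m t).filter (fun y => ¬ crossings l y = ∅), I y < J y := by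
    intro y hy
    have := h1 y hy
    exact Fin.lt_def.2 (by omega)
  have hadd := fun y hy => add_exchange (hl (hlt y hy).le) (h2 y hy)
  have hclosed : ∀ y ∈ (comps m t).filter (fun y => ¬ crossings l y = ∅),
      exchange l (I y) (J y) y ∈ (comps m t).filter (fun y => ¬ crossings l y = ∅) := by
    intro y hy
    rw [Finset.mem_filter, mem_comps]
    constructor
    · have e1 : ∑ k, (l k + (exchange l (I y) (J y) y k : ℤ)) = ∑ k, (l k + (y k : ℤ)) := by
        rw [← Equiv.sum_comp (Equiv.swap (I y) (J y)) fun k => l k + (y k : ℤ)]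
        exact Finset.sum_congr rfl fun k _ => congrFun (hadd y hy) k
      rw [Finset.sum_add_distrib, Finset.sum_add_distrib] at e1
      have e2 := mem_comps.1 (Finset.mem_filter.1 hy).1
      linarith
    · refine Finset.ne_empty_of_mem (a := J y) (Finset.mem_filter.2 ⟨Finset.mem_univ _, I y,
        h1 y hy, ?_⟩)
      have e := congrFun (hadd y hy) (J y)
      simp only [Function.comp_apply, Equiv.swap_apply_right] at e
      omega
  have hsame : ∀ y ∈ (comps m t).filter (fun y => ¬ crossings l y = ∅),
      I (exchange l (I y) (J y) y) = I y ∧ J (exchange l (I y) (J y) y) = J y := by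
    intro y hy
    set z := exchange l (I y) (J y) y with hz
    have hzm := hclosed y hy
    rw [← hz] at hzm
    have hJ : J z = J y := by
      refine le_antisymm ?_ ?_
      · by_contra! hgt
        have e := congrFun (hadd y hy) (J z)
        simp only [Function.comp_apply] at e
        rw [Equiv.swap_apply_of_ne_of_ne ((hlt y hy).trans hgt).ne' hgt.ne', ← hz] at e
        refine absurd (h3 y hy (J z) (Finset.mem_filter.2 ⟨Finset.mem_univ _, I z, h1 z hzm, ?_⟩))
          (not_le.2 hgt)
        rw [← e]
        exact h2 z hzm
      · refine h3 z hzm _ (Finset.mem_filter.2 ⟨Finset.mem_univ _, I y, h1 y hy, ?_⟩)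
        have e := congrFun (hadd y hy) (J y)
        simp only [Function.comp_apply, Equiv.swap_apply_right, ← hz] at e
        omega
    refine ⟨?_, hJ⟩
    have e1 := h1 z hzm
    have e2 := h1 y hy
    rw [hJ] at e1
    exact Fin.ext (by omega)
  refine Finset.sum_involution (fun y _ => exchange l (I y) (J y) y) ?_ ?_ hclosed ?_
  · intro y hy
    rw [hadd y hy, hG _ _ _ (hlt y hy).ne]
    ring
  · intro y hy hne heq
    refine hne ?_
    have e := hG (fun k => l k + (y k : ℤ)) _ _ (hlt y hy).ne
    rw [← hadd y hy, heq] at e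
    omega
  · intro y hy
    have e := hadd _ (hclosed y hy)
    rw [(hsame y hy).1, (hsame y hy).2] at e
    rw [hadd y hy] at e
    funext k
    have e := congrFun e k
    simp only [Function.comp_apply, Equiv.swap_apply_self] at e
    simp only [(hsame y hy).1, (hsame y hy).2]
    omega

/-! ### The recursion computes the alternating sums -/

theorem sum_range_eq_of_vanish {μ : ℕ → ℕ} {m K : ℕ} (hμ : ∀ i, m ≤ i → μ i = 0) (hK : m ≤ K) :
    ∑ i ∈ Finset.range K, μ i = ∑ i ∈ Finset.range m, μ i :=
  (Finset.sum_subset (Finset.range_mono hK) fun i _ hi =>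
    hμ i (by simpa using hi)).symm

theorem sizeEq_iff {x j m : ℕ} {ν μ μ' : ℕ → ℕ} (hμ : ∀ i, m ≤ i → μ i = 0)
    (hμ' : ∀ i, m ≤ i → μ' i = 0) :
    SizeEq x j ν μ μ' ↔
      x + j + ∑ i ∈ Finset.range m, μ' i = ν j + ∑ i ∈ Finset.range m, μ i := by
  constructor
  · rintro ⟨K, hK⟩
    have h := hK (m + K) (by omega)
    rwa [sum_range_eq_of_vanish hμ (by omega), sum_range_eq_of_vanish hμ' (by omega)] at h
  · intro h
    refine ⟨m, fun K hK => ?_⟩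
    rwa [sum_range_eq_of_vanish hμ hK, sum_range_eq_of_vanish hμ' hK]

/-- The sequence of `m` terms `μ i + y i`, continued by zeros. -/
def addPad {m : ℕ} (μ : ℕ → ℕ) (y : Fin m → ℕ) : ℕ → ℕ :=
  fun i => if h : i < m then μ i + y ⟨i, h⟩ else 0

theorem addPad_of_lt {m : ℕ} (μ : ℕ → ℕ) (y : Fin m → ℕ) {i : ℕ} (h : i < m) :
    addPad μ y i = μ i + y ⟨i, h⟩ := dif_pos h

theorem addPad_of_ge {m : ℕ} (μ : ℕ → ℕ) (y : Fin m → ℕ) {i : ℕ} (h : m ≤ i) :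
    addPad μ y i = 0 := dif_neg (by omega)

theorem sum_addPad {m : ℕ} (μ : ℕ → ℕ) (y : Fin m → ℕ) :
    ∑ i ∈ Finset.range m, addPad μ y i = ∑ i ∈ Finset.range m, μ i + ∑ i, y i := by
  rw [Finset.sum_range, Finset.sum_range, ← Finset.sum_add_distrib]
  exact Finset.sum_congr rfl fun i _ => addPad_of_lt μ y i.2

theorem strip_addPad_iff {m : ℕ} {μ : ℕ → ℕ} (hμ : ∀ i, m ≤ i → μ i = 0) (y : Fin m → ℕ) :
    Strip μ (addPad μ y) ↔ crossings (fun i : Fin m => (μ i : ℤ) - (i : ℕ)) y = ∅ := by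
  rw [Finset.eq_empty_iff_forall_notMem]
  constructor
  · rintro hs j hj
    obtain ⟨i, hij, h⟩ := (Finset.mem_filter.1 hj).2
    have h1 := hs.2 i
    rw [hij, addPad_of_lt μ y j.2] at h1
    simp only [Fin.eta] at h1 h
    omega
  · intro hc
    refine ⟨fun i => ?_, fun i => ?_⟩
    · rcases lt_or_ge i m with h | h
      · rw [addPad_of_lt μ y h]; omega
      · rw [hμ i h]; omega
    · rcases lt_or_ge (i + 1) m with h | h
      · rw [addPad_of_lt μ y h]
        by_contra! hlt
        refine hc ⟨i + 1, h⟩ (Finset.mem_filter.2 ⟨Finset.mem_univ _, ⟨i, by omega⟩, rfl, ?_⟩)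
        push_cast
        omega
      · rw [addPad_of_ge μ y h]; omega

theorem delPart_vanish {ν : ℕ → ℕ} {n j : ℕ} (hν : ∀ i, n + 1 ≤ i → ν i = 0) (hj : j ≤ n) :
    ∀ i, n ≤ i → delPart ν j i = 0 := by
  intro i hi
  simp [delPart, show ¬ i < j by omega, hν (i + 1) (by omega)]

theorem delPart_sub_eq (ν : ℕ → ℕ) {n : ℕ} (j : Fin (n + 1)) (i : Fin n) :
    ((delPart ν j i : ℕ) : ℤ) - (i : ℕ) =
      ((ν (j.succAbove i) : ℕ) : ℤ) - ((j.succAbove i : Fin (n + 1)) : ℕ) + 1 := by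
  rcases lt_or_ge (i : ℕ) (j : ℕ) with h | h
  · rw [Fin.succAbove_of_castSucc_lt _ _ (by simpa [Fin.lt_def] using h)]
    simp [delPart, h]
    ring
  · rw [Fin.succAbove_of_le_castSucc _ _ (by simpa [Fin.le_def] using h)]
    simp [delPart, show ¬ (i : ℕ) < j by omega]
    ring

open Classical in
theorem wordMult_true_cons_eq_altCount {x : ℕ} {W : Word}
    (ih : ∀ ν μ : ℕ → ℕ, Antitone ν → Antitone μ → (∀ i, count true W ≤ i → ν i = 0) →
      (∀ i, count false W ≤ i → μ i = 0) →
      wordMult W ν μ = altCount W (count true W) (count false W)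
        (fun i => (ν i : ℤ) - (i : ℕ)) (fun i => (μ i : ℤ) - (i : ℕ)))
    {ν μ : ℕ → ℕ} (hν : Antitone ν) (hμ : Antitone μ)
    (hν0 : ∀ i, count true W + 1 ≤ i → ν i = 0) (hμ0 : ∀ i, count false W ≤ i → μ i = 0) :
    wordMult ((true, x) :: W) ν μ = altCount ((true, x) :: W) (count true W + 1) (count false W)
      (fun i => (ν i : ℤ) - (i : ℕ)) (fun i => (μ i : ℤ) - (i : ℕ)) := by
  rw [altCount_true_cons]
  have hanti : Antitone fun i : Fin (count false W) => (μ i : ℤ) - (i : ℕ) := by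
    intro i j hij
    have h1 : μ j ≤ μ i := hμ hij
    have h2 : (i : ℕ) ≤ j := hij
    dsimp only
    omega
  have hpieri := fun κ => sum_comps_eq_sum_filter
    (G := altCount W (count true W) (count false W) κ)
    (fun l i j hij => altCount_comp_swap W _ _ κ l hij) hanti
  set n := count true W with hn
  set m := count false W with hm
  set l : Fin m → ℤ := fun i => (μ i : ℤ) - (i : ℕ) with hl
  set C : Fin (n + 1) → Finset (Fin m → ℕ) := fun j =>
    (comps m ((ν j : ℤ) - (j : ℕ) - x)).filter fun y => crossings l y = ∅ with hC
  set φ : (Σ _ : Fin (n + 1), Fin m → ℕ) → ℕ × (ℕ → ℕ) :=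
    fun p => ((p.1 : ℕ), addPad μ p.2) with hφ
  have hφi : Function.Injective φ := by
    rintro ⟨j, y⟩ ⟨j', y'⟩ h
    simp only [hφ, Prod.mk.injEq] at h
    obtain ⟨h1, h2⟩ := h
    obtain rfl := Fin.ext h1
    congr 1
    funext i
    have h3 := congrFun h2 i
    rw [addPad_of_lt μ y i.2, addPad_of_lt μ y' i.2] at h3
    simpa using h3
  have hcond : ∀ (j : Fin (n + 1)) (y : Fin m → ℕ),
      (Strip μ (addPad μ y) ∧ SizeEq x j ν μ (addPad μ y)) ↔ y ∈ C j := by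
    intro j y
    rw [strip_addPad_iff hμ0, sizeEq_iff hμ0 (fun i => addPad_of_ge μ y), sum_addPad,
      Finset.mem_filter, mem_comps, ← Nat.cast_sum, and_comm]
    refine and_congr_left' ?_
    generalize ∑ i, y i = a
    omega
  rw [wordMult, prefixLetter, finsum_eq_sum_of_support_subset
    (s := (Finset.univ.sigma C).image φ), Finset.sum_image hφi.injOn, Finset.sum_sigma]
  · refine Finset.sum_congr rfl fun j _ => ?_
    rw [hpieri, Finset.mul_sum]
    refine Finset.sum_congr rfl fun y hy => ?_
    have hc := (hcond j y).2 hy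
    rw [if_pos hc, ih _ _ (antitone_delPart hν j) hc.1.antitone
      (delPart_vanish hν0 (by omega)) (fun i => addPad_of_ge μ y)]
    congr 2
    · funext i
      exact delPart_sub_eq ν j i
    · funext i
      rw [addPad_of_lt μ y i.2]
      simp only [Fin.eta]
      push_cast
      ring
  · rintro ⟨j, μ'⟩ hp
    simp only [Function.mem_support, ne_eq, ite_eq_right_iff, Classical.not_imp] at hp
    obtain ⟨⟨hs, hz⟩, h0⟩ := hp
    obtain ⟨h1, h2⟩ := wordMult_support W _ _ (right_ne_zero_of_mul h0)
    have hj : j ≤ n := by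
      by_contra! hj
      simpa [delPart, hj] using h1 n le_rfl
    have hy : addPad μ (fun i : Fin m => μ' i - μ i) = μ' := by
      funext i
      rcases lt_or_ge i m with h | h
      · rw [addPad_of_lt _ _ h]
        have := hs.1 i
        dsimp only
        omega
      · rw [addPad_of_ge _ _ h, h2 i h]
    simp only [Finset.coe_image, Set.mem_image, Finset.mem_coe, Finset.mem_sigma,
      Finset.mem_univ, true_and]
    refine ⟨⟨⟨j, by omega⟩, fun i : Fin m => μ' i - μ i⟩, (hcond _ _).1 ?_, ?_⟩
    · rw [hy]; exact ⟨hs, hz⟩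
    · simp only [hφ, hy]

/-- Pieri's rule turns the expansion of `altCount` along the first row into the recursion that
defines `wordMult`. -/
theorem wordMult_eq_altCount (W : Word) : ∀ ν μ : ℕ → ℕ, Antitone ν → Antitone μ →
    (∀ i, count true W ≤ i → ν i = 0) → (∀ i, count false W ≤ i → μ i = 0) →
    wordMult W ν μ = altCount W (count true W) (count false W)
      (fun i => (ν i : ℤ) - (i : ℕ)) (fun i => (μ i : ℤ) - (i : ℕ)) := by
  refine flip_induction (P := fun W => ∀ ν μ : ℕ → ℕ, Antitone ν → Antitone μ →
    (∀ i, count true W ≤ i → ν i = 0) → (∀ i, count false W ≤ i → μ i = 0) →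
    wordMult W ν μ = altCount W (count true W) (count false W)
      (fun i => (ν i : ℤ) - (i : ℕ)) (fun i => (μ i : ℤ) - (i : ℕ))) ?_ ?_ ?_ W
  · intro W ih ν μ hν hμ h1 h2
    rw [wordMult_flip, ih μ ν hμ hν (by simpa using h2) (by simpa using h1)]
    have h := altCount_flip (flip W) (count true (flip W)) (count false (flip W))
      (fun i => (ν i : ℤ) - (i : ℕ)) (fun i => (μ i : ℤ) - (i : ℕ))
    rw [← h, flip_flip, count_flip, count_flip]
    rfl
  · intro ν μ hν hμ h1 h2
    have hν0 : ν = 0 := funext fun i => h1 i (by simp)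
    have hμ0 : μ = 0 := funext fun i => h2 i (by simp)
    have h : ∀ κ l, altCount [] 0 0 κ l = 1 := by
      intro κ l
      simp [altCount, rawCount]
    rw [wordMult, if_pos ⟨hν0, hμ0⟩]
    exact (h _ _).symm
  · intro x W ih ν μ hν hμ h1 h2
    have e1 : count true ((true, x) :: W) = count true W + 1 := by simp
    have e2 : count false ((true, x) :: W) = count false W := by simp
    rw [e1] at h1
    rw [e2] at h2
    rw [e1, e2]
    exact wordMult_true_cons_eq_altCount ih hν hμ h1 h2

/-! ### The multiplicity of a pair of partitions -/

/-- A finite sequence, continued by zeros. -/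
def pad {k : ℕ} (ν : Fin k → ℕ) : ℕ → ℕ := fun i => if h : i < k then ν ⟨i, h⟩ else 0

@[simp] theorem pad_fin {k : ℕ} (ν : Fin k → ℕ) (i : Fin k) : pad ν i = ν i := by simp [pad]

theorem pad_of_ge {k : ℕ} (ν : Fin k → ℕ) {i : ℕ} (h : k ≤ i) : pad ν i = 0 :=
  dif_neg (by omega)

theorem antitone_pad {k : ℕ} {ν : Fin k → ℕ} (hν : Antitone ν) : Antitone (pad ν) := by
  intro i j hij
  unfold pad
  split_ifs with h1 h2
  · exact hν hij
  · omega
  · exact Nat.zero_le _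
  · exact le_rfl

variable {n m : ℕ}

theorem sum_idx (F : Idx n m → ℤ) :
    ∑ q, F q = ∑ i, F (Idx.a i) + ∑ j, F (Idx.b j) := by
  rw [← (Idx.equivSum n m).sum_comp, Fintype.sum_sum_type]
  rfl

theorem before_iff_of_pairwise [LinearOrder (Idx n m)] {S : List (Idx n m)}
    (hS : S.Pairwise (· < ·)) {p q : Idx n m} : Before S p q ↔ p ∈ S ∧ q ∈ S ∧ p < q := by
  induction S with
  | nil => simp [Before]
  | cons a S ih =>
    rw [List.pairwise_cons] at hS
    simp only [Before, ih hS.2, List.mem_cons]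
    constructor
    · rintro (⟨rfl, hq⟩ | ⟨hp, hq, h⟩)
      · exact ⟨Or.inl rfl, Or.inr hq, hS.1 q hq⟩
      · exact ⟨Or.inr hp, Or.inr hq, h⟩
    · rintro ⟨rfl | hp, rfl | hq, h⟩
      · exact (lt_irrefl _ h).elim
      · exact Or.inl ⟨rfl, hq⟩
      · exact (lt_asymm h (hS.1 p hp)).elim
      · exact Or.inr ⟨hp, hq, h⟩

/-- The indices in increasing order. -/
abbrev letters (n m : ℕ) [LinearOrder (Idx n m)] : List (Idx n m) :=
  (Finset.univ : Finset (Idx n m)).sort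

theorem pairwise_letters [LinearOrder (Idx n m)] : (letters n m).Pairwise (· < ·) :=
  (Finset.sortedLT_sort _).pairwise

theorem mem_letters [LinearOrder (Idx n m)] (p : Idx n m) : p ∈ letters n m := by
  simp [letters]

theorem filter_letters [LinearOrder (Idx n m)]
    (hI0 : ∀ i j : Fin n, (Idx.a i : Idx n m) < Idx.a j ↔ i < j)
    (hI1 : ∀ i j : Fin m, (Idx.b i : Idx n m) < Idx.b j ↔ i < j) :
    (letters n m).filter (fun p => p.kind) = List.ofFn Idx.a ∧
      (letters n m).filter (fun p => !p.kind) = List.ofFn Idx.b := by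
  have key : ∀ (f : Idx n m → Bool) (L : List (Idx n m)), L.Pairwise (· < ·) →
      (∀ p, p ∈ L ↔ f p = true) → (letters n m).filter f = L := by
    intro f L hL hmem
    have h1 : ((letters n m).filter f).Pairwise (· < ·) := pairwise_letters.filter _
    refine List.Perm.eq_of_pairwise (le := (· < ·)) (fun a b _ _ h h' => (lt_asymm h h').elim)
      h1 hL ?_
    rw [List.perm_ext_iff_of_nodup (h1.imp ne_of_lt) (hL.imp ne_of_lt)]
    intro p
    simp [List.mem_filter, hmem]
  refine ⟨key _ _ ?_ ?_, key _ _ ?_ ?_⟩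
  · rw [List.pairwise_ofFn]
    exact fun i j hij => (hI0 i j).2 hij
  · rintro (i | j) <;> simp [Idx.kind, List.mem_ofFn]
  · rw [List.pairwise_ofFn]
    exact fun i j hij => (hI1 i j).2 hij
  · rintro (i | j) <;> simp [Idx.kind, List.mem_ofFn]

/-- The elements of `X(α, β; ν, μ)` are the flows on the list of all indices. -/
noncomputable def xSetEquiv [LinearOrder (Idx n m)] (α : Fin n → ℕ) (β : Fin m → ℕ)
    (κ : Idx n m → ℤ) :
    XSet α β (κ ∘ Idx.a) (κ ∘ Idx.b) ≃
      {x // IsFlow Idx.kind (Idx.val α β) (letters n m) κ x} := by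
  have hbefore : ∀ p q, Before (letters n m) p q ↔ p < q := fun p q => by
    rw [before_iff_of_pairwise pairwise_letters]
    simp
  -- the balance at every index, in terms of a matrix indexed by all pairs of indices
  have hbal : ∀ (x : JSet n m → ℕ),
      x ∈ XSet α β (κ ∘ Idx.a) (κ ∘ Idx.b) ↔ ∀ p, (Idx.val α β p : ℤ) +
        ∑ q, coord x p q - ∑ q, coord x q p = κ p := by
    intro x
    have hz : ∀ p q : Idx n m, p.kind = q.kind → coord x p q = 0 := by
      intro p q h
      rw [coord, dif_neg]
      exact fun h' => h'.2 h
    have ha : ∀ i i' : Fin n, coord x (Idx.a i) (Idx.a i') = 0 := fun _ _ => hz _ _ rfl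
    have hb : ∀ j j' : Fin m, coord x (Idx.b j) (Idx.b j') = 0 := fun _ _ => hz _ _ rfl
    constructor
    · rintro ⟨h1, h2⟩ (i | j)
      · rw [sum_idx, sum_idx]
        simpa [ha, Idx.val, twistA] using congrFun h1 i
      · rw [sum_idx, sum_idx]
        simpa [hb, Idx.val, twistB] using congrFun h2 j
    · intro h
      refine ⟨funext fun i => ?_, funext fun j => ?_⟩
      · have h := h (Idx.a i)
        rw [sum_idx, sum_idx] at h
        simpa [ha, Idx.val, twistA] using h
      · have h := h (Idx.b j)
        rw [sum_idx, sum_idx] at h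
        simpa [hb, Idx.val, twistB] using h
  have hcoord : ∀ (x : JSet n m → ℕ) p q, ((coord x p q).toNat : ℤ) = coord x p q := by
    intro x p q
    rw [coord]
    split_ifs <;> simp
  have hback : ∀ (x : Idx n m → Idx n m → ℕ),
      IsFlow Idx.kind (Idx.val α β) (letters n m) κ x →
      ∀ p q, coord (fun r : JSet n m => x r.1.1 r.1.2) p q = x p q := by
    intro x hx p q
    rw [coord]
    split_ifs with h
    · rfl
    · by_contra h0
      have h1 := hx.1 p q (by intro h; simp [h] at h0)
      exact h ⟨(hbefore p q).1 h1.1, h1.2⟩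
  refine
    { toFun := fun x => ⟨fun p q => (coord x.1 p q).toNat, ?_, ?_⟩
      invFun := fun x => ⟨fun r => x.1 r.1.1 r.1.2, ?_⟩
      left_inv := ?_
      right_inv := ?_ }
  · intro p q h
    rw [hbefore]
    by_contra h'
    refine h ?_
    dsimp only
    rw [coord, dif_neg h', Int.toNat_zero]
  · intro p _
    simp only [hcoord]
    exact (hbal x.1).1 x.2 p
  · rw [hbal]
    intro p
    simp only [hback x.1 x.2]
    exact x.2.2 p (mem_letters p)
  · rintro ⟨x, hx⟩
    refine Subtype.ext (funext fun r => ?_)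
    dsimp only
    rw [coord, dif_pos r.2, Int.toNat_natCast]
    rfl
  · rintro ⟨x, hx⟩
    refine Subtype.ext (funext fun p => funext fun q => ?_)
    dsimp only
    rw [hback x hx]
    simp

/-- The word of `(α, β)` for the order of the indices. -/
abbrev pairWord [LinearOrder (Idx n m)] (α : Fin n → ℕ) (β : Fin m → ℕ) : Word :=
  wordOf Idx.kind (Idx.val α β) (letters n m)

theorem pairMult_eq_wordMult [LinearOrder (Idx n m)]
    (hI0 : ∀ i j : Fin n, (Idx.a i : Idx n m) < Idx.a j ↔ i < j)
    (hI1 : ∀ i j : Fin m, (Idx.b i : Idx n m) < Idx.b j ↔ i < j)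
    (α : Fin n → ℕ) (β : Fin m → ℕ) {ν : Fin n → ℕ} {μ : Fin m → ℕ} (hν : Antitone ν)
    (hμ : Antitone μ) : pairMult α β ν μ = wordMult (pairWord α β) (pad ν) (pad μ) := by
  have hf := filter_letters hI0 hI1
  have hcnt : ∀ e, count e (pairWord α β) = Idx.cnt e (letters n m) := by
    intro e
    simp [count, wordOf, Idx.cnt, List.countP_map, Function.comp_def]
  have hn : count true (pairWord α β) = n := (hcnt true).trans Idx.cnt_sort_univ.1
  have hm : count false (pairWord α β) = m := (hcnt false).trans Idx.cnt_sort_univ.2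
  rw [wordMult_eq_altCount _ _ _ (antitone_pad hν) (antitone_pad hμ)
    (fun i hi => pad_of_ge ν (hn ▸ hi)) (fun i hi => pad_of_ge μ (hm ▸ hi)), hn, hm]
  unfold pairMult altCount
  refine Finset.sum_congr rfl fun w _ => Finset.sum_congr rfl fun v _ => ?_
  congr 1
  have h := card_isFlow (Idx.val α β) (letters n m) (pairwise_letters.imp ne_of_lt) Idx.kind
    (fun p => match p with
      | Idx.a i => shiftPerm ν w i
      | Idx.b j => shiftPerm μ v j) n m Idx.a Idx.b hf.1 hf.2
  have hE := Nat.card_congr (xSetEquiv α β (fun p => match p with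
      | Idx.a i => shiftPerm ν w i
      | Idx.b j => shiftPerm μ v j))
  rw [← hE] at h
  refine (Eq.trans ?_ h.2).trans ?_
  · rw [Nat.card_coe_set_eq]
    rfl
  · congr 1
    · funext i
      simp only [Function.comp_apply, shiftPerm, pad_fin]
      ring
    · funext i
      simp only [Function.comp_apply, shiftPerm, pad_fin]
      ring

/-! ### Multisets of natural numbers as non-increasing sequences -/

/-- The terms of a multiset in non-increasing order, continued by zeros. -/
def desc (S : Multiset ℕ) : ℕ → ℕ := fun i => (S.sort fun x y => y ≤ x).getD i 0

theorem map_desc (S : Multiset ℕ) : (Multiset.range S.card).map (desc S) = S := by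
  have hl : (S.sort fun x y => y ≤ x).length = S.card := Multiset.length_sort _
  have h : (List.range S.card).map (desc S) = S.sort fun x y => y ≤ x := by
    refine List.ext_getElem (by simp) fun i h1 h2 => ?_
    rw [List.getElem_map, List.getElem_range, desc, List.getD_eq_getElem _ _ h2]
  rw [Multiset.range, Multiset.map_coe, h, Multiset.sort_eq]

theorem desc_of_ge (S : Multiset ℕ) {i : ℕ} (h : S.card ≤ i) : desc S i = 0 :=
  List.getD_eq_default _ _ (by rwa [Multiset.length_sort])

theorem pairwise_map_range {R : Type*} [Preorder R] {h : ℕ → R} (hh : Antitone h) (k : ℕ) :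
    ((List.range k).map h).Pairwise fun x y => y ≤ x := by
  rw [List.pairwise_map]
  exact List.pairwise_lt_range.imp fun hij => hh hij.le

theorem desc_map_range {f : ℕ → ℕ} (hf : Antitone f) {k : ℕ} (h0 : ∀ i, k ≤ i → f i = 0) :
    desc ((Multiset.range k).map f) = f := by
  have h : ((Multiset.range k).map f).sort (fun x y => y ≤ x) = (List.range k).map f := by
    refine List.Perm.eq_of_pairwise (le := fun x y => y ≤ x) (fun a b _ _ h h' => le_antisymm h' h)
      (Multiset.pairwise_sort _ _) (pairwise_map_range hf k) ?_
    rw [← Multiset.coe_eq_coe, Multiset.sort_eq, Multiset.range, Multiset.map_coe]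
  funext i
  rw [desc, h]
  rcases lt_or_ge i k with hi | hi
  · rw [List.getD_eq_getElem _ _ (by simpa using hi)]
    simp
  · rw [List.getD_eq_default _ _ (by simpa using hi), h0 i hi]

theorem antitone_desc (S : Multiset ℕ) : Antitone (desc S) := by
  intro i j hij
  unfold desc
  rcases lt_or_ge j (S.sort fun x y => y ≤ x).length with hj | hj
  · rw [List.getD_eq_getElem _ _ hj, List.getD_eq_getElem _ _ (hij.trans_lt hj)]
    rcases hij.lt_or_eq with hlt | rfl
    · exact List.pairwise_iff_getElem.1 (Multiset.pairwise_sort S fun x y : ℕ => y ≤ x) _ _ _ _ hlt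
    · exact le_rfl
  · rw [List.getD_eq_default _ _ hj]
    exact Nat.zero_le _

theorem map_range_add_zeros {f : ℕ → ℕ} {k : ℕ} (h0 : ∀ i, k ≤ i → f i = 0) (c : ℕ) :
    (Multiset.range (k + c)).map f = (Multiset.range k).map f + Multiset.replicate c 0 := by
  induction c with
  | zero => simp
  | succ c ih =>
    rw [← add_assoc, Multiset.range_succ, Multiset.map_cons, ih, h0 _ (by omega),
      Multiset.replicate_succ, Multiset.add_cons]

theorem map_range_prepend {R : Type*} (h : ℕ → R) (k : ℕ) :
    (Multiset.range (k + 1)).map h = h 0 ::ₘ (Multiset.range k).map fun i => h (i + 1) := by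
  induction k with
  | zero => simp
  | succ k ih =>
    rw [Multiset.range_succ, Multiset.map_cons, ih, Multiset.range_succ, Multiset.map_cons,
      Multiset.cons_swap]

theorem desc_add_zeros (S : Multiset ℕ) (c : ℕ) : desc (S + Multiset.replicate c 0) = desc S := by
  conv_lhs => rw [← map_desc S]
  rw [← map_range_add_zeros fun i => desc_of_ge S]
  exact desc_map_range (antitone_desc S) fun i hi => desc_of_ge S (by omega)

theorem desc_cons {S : Multiset ℕ} {d : ℕ} (h : desc S 0 ≤ d) :
    desc (d ::ₘ S) = prepend d (desc S) := by
  have h1 := map_range_prepend (prepend d (desc S)) S.card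
  simp only [prepend_zero, prepend_succ] at h1
  rw [map_desc] at h1
  rw [← h1]
  refine desc_map_range (antitone_prepend (antitone_desc S) h) fun i hi => ?_
  obtain ⟨i, rfl⟩ : ∃ i', i = i' + 1 := ⟨i - 1, by omega⟩
  exact desc_of_ge S (by omega)

theorem terms_eq_map_range {R : Type} (h : ℕ → R) (k : ℕ) :
    terms (fun i : Fin k => h i) = (Multiset.range k).map h := by
  have e : List.ofFn (fun i : Fin k => h i) = (List.range k).map h :=
    List.ext_getElem (by simp) fun i h1 h2 => by simp
  rw [terms, Fin.univ_val_map, e, Multiset.range, Multiset.map_coe]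

theorem terms_eq_map_pad {k : ℕ} (ν : Fin k → ℕ) :
    terms ν = (Multiset.range k).map (pad ν) := by
  rw [← terms_eq_map_range]
  simp only [pad_fin]

theorem desc_terms {k : ℕ} {ν : Fin k → ℕ} (hν : Antitone ν) : desc (terms ν) = pad ν := by
  rw [terms_eq_map_pad]
  exact desc_map_range (antitone_pad hν) fun i hi => pad_of_ge ν hi

/-! ### Sums of the largest terms -/

theorem sum_le_sum_take {L : List ℝ} (hL : L.Pairwise fun x y => y ≤ x) {t : Multiset ℝ} {k : ℕ}
    (ht : t ≤ (L : Multiset ℝ)) (hk : t.card = k) : t.sum ≤ (L.take k).sum := by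
  induction L generalizing t k with
  | nil =>
    have : t = 0 := by simpa using ht
    subst this
    simp
  | cons x L ih =>
    rw [List.pairwise_cons] at hL
    cases k with
    | zero => rw [Multiset.card_eq_zero.1 hk]; simp
    | succ k =>
      rw [List.take_succ_cons, List.sum_cons]
      by_cases hx : x ∈ t
      · obtain ⟨t, rfl⟩ := Multiset.exists_cons_of_mem hx
        rw [← Multiset.cons_coe, Multiset.cons_le_cons_iff] at ht
        rw [Multiset.sum_cons]
        have := ih hL.2 ht (by simpa using hk)
        linarith
      · rw [← Multiset.cons_coe, Multiset.le_cons_of_notMem hx] at ht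
        obtain ⟨y, hy⟩ := Multiset.card_pos_iff_exists_mem.1 (show 0 < t.card by omega)
        have hyx := hL.1 y (by simpa using Multiset.mem_of_le ht hy)
        obtain ⟨t, rfl⟩ := Multiset.exists_cons_of_mem hy
        rw [Multiset.sum_cons]
        have := ih hL.2 ((Multiset.le_cons_self t y).trans ht) (by simpa using hk)
        linarith

theorem sum_le_partialSum {t l : Multiset ℝ} (h : t ≤ l) : t.sum ≤ partialSum t.card l :=
  sum_le_sum_take (Multiset.pairwise_sort l fun x y => y ≤ x) (by rwa [Multiset.sort_eq]) rfl

theorem exists_sum_eq_partialSum {l : Multiset ℝ} {k : ℕ} (hk : k ≤ l.card) :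
    ∃ t ≤ l, t.card = k ∧ t.sum = partialSum k l := by
  refine ⟨((l.sort fun x y => y ≤ x).take k : List ℝ), ?_, ?_, ?_⟩
  · conv_rhs => rw [← Multiset.sort_eq l fun x y => y ≤ x]
    exact Multiset.coe_le.2 (List.take_sublist _ _).subperm
  · simp [Multiset.length_sort, hk]
  · simp [partialSum]

theorem add_partialSum_le (x : ℝ) {l : Multiset ℝ} {k : ℕ} (hk : k ≤ l.card) :
    x + partialSum k l ≤ partialSum (k + 1) (x ::ₘ l) := by
  obtain ⟨t, ht, hc, hs⟩ := exists_sum_eq_partialSum hk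
  have h := sum_le_partialSum ((Multiset.cons_le_cons_iff x).2 ht)
  rwa [Multiset.sum_cons, Multiset.card_cons, hc, hs] at h

theorem eq_of_partialSum_eq {l l' : Multiset ℝ} (hc : l.card = l'.card)
    (h : ∀ k ≤ l.card, partialSum k l = partialSum k l') : l = l' := by
  have e : l.sort (fun x y => y ≤ x) = l'.sort (fun x y => y ≤ x) := by
    refine List.ext_getElem (by simp [Multiset.length_sort, hc]) fun i h1 h2 => ?_
    have hi : i < l.card := by rwa [Multiset.length_sort] at h1
    have e1 := h i hi.le
    have e2 := h (i + 1) hi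
    unfold partialSum at e1 e2
    rw [List.sum_take_succ _ _ h1, List.sum_take_succ _ _ h2, e1] at e2
    linarith
  rw [← Multiset.sort_eq l fun x y => y ≤ x, e, Multiset.sort_eq]

/-! ### Symbols -/

/-- The terms `f i + A - s i` for `i < N`. -/
def row (N : ℕ) (A s : ℝ) (f : ℕ → ℕ) : Multiset ℝ :=
  (Multiset.range N).map fun i => (f i : ℝ) + (A - s * i)

/-- The multiset `pΛ` of two zero-padded partitions. -/
def symbol (N M : ℕ) (A B s : ℝ) (f g : ℕ → ℕ) : Multiset ℝ := row N A s f + row M B s g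

theorem pLambda_eq_symbol {n m : ℕ} (N M : ℕ) (A B s : ℝ) (ν : Fin n → ℕ) (μ : Fin m → ℕ) :
    pLambda N M A B s ν μ = symbol N M A B s (pad ν) (pad μ) := by
  have h : ∀ (K : ℕ) (C : ℝ) {k : ℕ} (τ : Fin k → ℕ),
      terms (symbolRow K C s τ) = row K C s (pad τ) := by
    intro K C k τ
    rw [row, ← terms_eq_map_range]
    congr 1
    funext i
    unfold symbolRow pad
    split_ifs <;> simp
  rw [pLambda, symbol, h, h]

@[simp] theorem card_row (N : ℕ) (A s : ℝ) (f : ℕ → ℕ) : (row N A s f).card = N := by simp [row]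

@[simp] theorem card_symbol (N M : ℕ) (A B s : ℝ) (f g : ℕ → ℕ) :
    (symbol N M A B s f g).card = N + M := by simp [symbol]

theorem row_prepend (N : ℕ) (A s : ℝ) (d : ℕ) (f : ℕ → ℕ) :
    row (N + 1) A s (prepend d f) = ((d : ℝ) + A) ::ₘ row N (A - s) s f := by
  rw [row, map_range_prepend, row]
  simp only [prepend_zero, prepend_succ, Nat.cast_zero, mul_zero, sub_zero]
  congr 1
  refine Multiset.map_congr rfl fun i _ => ?_
  push_cast
  ring

theorem symbol_prepend_left (N M : ℕ) (A B s : ℝ) (d : ℕ) (f g : ℕ → ℕ) :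
    symbol (N + 1) M A B s (prepend d f) g = ((d : ℝ) + A) ::ₘ symbol N M (A - s) B s f g := by
  rw [symbol, row_prepend, Multiset.cons_add, symbol]

theorem symbol_prepend_right (N M : ℕ) (A B s : ℝ) (d : ℕ) (f g : ℕ → ℕ) :
    symbol N (M + 1) A B s f (prepend d g) = ((d : ℝ) + B) ::ₘ symbol N M A (B - s) s f g := by
  rw [symbol, row_prepend, Multiset.add_cons, symbol]

theorem antitone_row {f : ℕ → ℕ} (hf : Antitone f) (A : ℝ) {s : ℝ} (hs : 0 < s) :
    Antitone fun i : ℕ => (f i : ℝ) + (A - s * i) := by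
  intro i j hij
  have h1 : (f j : ℝ) ≤ f i := by exact_mod_cast hf hij
  have h2 : s * (i : ℝ) ≤ s * j := mul_le_mul_of_nonneg_left (by exact_mod_cast hij) hs.le
  dsimp only
  linarith

theorem eq_of_row_eq {f g : ℕ → ℕ} (hf : Antitone f) (hg : Antitone g) {N : ℕ} {A s : ℝ}
    (hs : 0 < s) (h : row N A s f = row N A s g) : ∀ i < N, f i = g i := by
  have h1 : (List.range N).map (fun i : ℕ => (f i : ℝ) + (A - s * i)) =
      (List.range N).map (fun i : ℕ => (g i : ℝ) + (A - s * i)) := by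
    refine List.Perm.eq_of_pairwise (le := fun x y => y ≤ x) (fun a b _ _ h h' => le_antisymm h' h)
      (pairwise_map_range (antitone_row hf A hs) N) (pairwise_map_range (antitone_row hg A hs) N) ?_
    rwa [← Multiset.coe_eq_coe, ← Multiset.map_coe, ← Multiset.map_coe]
  intro i hi
  have h2 := List.map_inj_left.1 h1 i (List.mem_range.2 hi)
  have h3 : (f i : ℝ) = g i := by simpa using h2
  exact_mod_cast h3

/-- The sum of the first `e` terms `A - s i` and the first `f` terms `B - s j`. -/
noncomputable def offset (A B s : ℝ) (e f : ℕ) : ℝ :=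
  ∑ i ∈ Finset.range e, (A - s * i) + ∑ j ∈ Finset.range f, (B - s * j)

theorem offset_succ_left (A B s : ℝ) (e f : ℕ) :
    offset A B s (e + 1) f = A + offset (A - s) B s e f := by
  rw [offset, offset, Finset.sum_range_succ']
  have h : ∀ i : ℕ, A - s * ((i + 1 : ℕ) : ℝ) = A - s - s * i := fun i => by push_cast; ring
  simp only [h, Nat.cast_zero]
  ring

theorem offset_succ_right (A B s : ℝ) (e f : ℕ) :
    offset A B s e (f + 1) = B + offset A (B - s) s e f := by
  rw [offset, add_comm, ← offset, offset_succ_left, offset, add_comm (Finset.sum _ _), ← offset]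

theorem sum_le_of_le_row {f : ℕ → ℕ} (hf : Antitone f) {N : ℕ} {A s : ℝ} (hs : 0 < s)
    {t : Multiset ℝ} (ht : t ≤ row N A s f) :
    t.sum ≤ ∑ i ∈ Finset.range t.card, ((f i : ℝ) + (A - s * i)) := by
  have hc : t.card ≤ N := by simpa using Multiset.card_le_card ht
  refine (sum_le_sum_take (pairwise_map_range (antitone_row hf A hs) N)
    (by rwa [← Multiset.map_coe]) rfl).trans (le_of_eq ?_)
  rw [← List.map_take, List.take_range, min_eq_left hc, Finset.sum_range, ← List.sum_ofFn]
  congr 1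
  exact List.ext_getElem (by simp) fun i h1 h2 => by simp

/-- The largest terms of a symbol are the first terms of its two rows. -/
theorem exists_partialSum_symbol_le {f g : ℕ → ℕ} (hf : Antitone f) (hg : Antitone g) {N M : ℕ}
    (A B : ℝ) {s : ℝ} (hs : 0 < s) {k : ℕ} (hk : k ≤ N + M) :
    ∃ e₁ ≤ N, ∃ e₂ ≤ M, e₁ + e₂ = k ∧ partialSum k (symbol N M A B s f g) ≤
      ((∑ i ∈ Finset.range e₁, f i + ∑ i ∈ Finset.range e₂, g i : ℕ) : ℝ) +
        offset A B s e₁ e₂ := by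
  obtain ⟨t, ht, hc, hsum⟩ := exists_sum_eq_partialSum (l := symbol N M A B s f g) (k := k)
    (by simpa using hk)
  have h1 : t ∩ row N A s f ≤ row N A s f := Multiset.inter_le_right
  have h2 : t - row N A s f ≤ row M B s g := tsub_le_iff_left.2 ht
  have h3 := Multiset.sub_add_inter t (row N A s f)
  refine ⟨_, by simpa using Multiset.card_le_card h1, _, by simpa using Multiset.card_le_card h2,
    ?_, ?_⟩
  · rw [← hc, ← Multiset.card_add, add_comm, h3]
  · rw [← hsum]
    have h4 := congrArg Multiset.sum h3
    rw [Multiset.sum_add] at h4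
    have h5 := sum_le_of_le_row hf hs h1
    have h6 := sum_le_of_le_row hg hs h2
    rw [Finset.sum_add_distrib] at h5 h6
    rw [← h4, offset]
    push_cast
    linarith

/-! ### Words with letters of one kind -/

/-- The values of the letters of kind `e`. -/
def vals (e : Bool) (W : Word) : Multiset ℕ := ((W.filter fun p => p.1 == e).map Prod.snd : List ℕ)

theorem card_vals (e : Bool) (W : Word) : (vals e W).card = count e W := by
  simp [vals, count, List.countP_eq_length_filter]

theorem vals_flip (e : Bool) (W : Word) : vals e (flip W) = vals (!e) W := by
  have h : ∀ p : Bool × ℕ, ((!p.1) == e) = (p.1 == !e) := by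
    rintro ⟨k, x⟩
    cases k <;> cases e <;> rfl
  simp [vals, flip, List.filter_map, Function.comp_def, h]

theorem vals_cons (e : Bool) (x : ℕ) (W : Word) : vals e ((e, x) :: W) = x ::ₘ vals e W := by
  simp [vals]

theorem desc_vals_le {e : Bool} {x : ℕ} {W : Word} (hW : KindAntitone ((e, x) :: W)) :
    desc (vals e W) 0 ≤ x := by
  rcases Nat.eq_zero_or_pos (vals e W).card with h | h
  · rw [desc_of_ge _ (by omega)]
    exact Nat.zero_le _
  · have h1 : desc (vals e W) 0 ∈ vals e W := by
      have h2 := Multiset.mem_map_of_mem (desc (vals e W)) (Multiset.mem_range.2 h)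
      rwa [map_desc] at h2
    generalize desc (vals e W) 0 = y at h1 ⊢
    rw [vals, Multiset.mem_coe, List.mem_map] at h1
    obtain ⟨p, hp, hx⟩ := h1
    rw [List.mem_filter] at hp
    rw [← hx]
    exact hW.le_head p hp.1 (by simpa using hp.2)

theorem greedy_zero_zero (W : Word) : greedy W 0 0 = 0 := by
  induction W with
  | nil => simp
  | cons p W ih => obtain ⟨k, x⟩ := p; cases k <;> simpa using ih

theorem greedy_of_count_false {W : Word} (h0 : count false W = 0) (f : ℕ) :
    greedy W 0 f = 0 ∧ unchained false W = W := by
  induction W with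
  | nil => simp [unchained]
  | cons p W ih =>
    obtain ⟨k, x⟩ := p
    cases k
    · simp at h0
    · have ih := ih (by simpa using h0)
      simp [unchained, ih]

theorem wordMult_of_count_false {W : Word} (hW : KindAntitone W) (h0 : count false W = 0) :
    wordMult W (desc (vals true W)) (desc (vals false W)) = 1 ∧
      ∀ e f, greedy W e f = ∑ i ∈ Finset.range e, desc (vals true W) i := by
  have hv : vals false W = 0 := by rw [← Multiset.card_eq_zero, card_vals, h0]
  have hd : desc (0 : Multiset ℕ) = 0 := funext fun i => desc_of_ge _ (by simp)
  rw [hv, hd]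
  clear hv
  induction W with
  | nil =>
    have : vals true [] = 0 := rfl
    simp [this, hd, wordMult]
  | cons p W ih =>
    obtain ⟨k, x⟩ := p
    cases k
    · simp at h0
    · have h0' : count false W = 0 := by simpa using h0
      have ih := ih hW.tail h0'
      have hg := greedy_of_count_false h0'
      rw [vals_cons, desc_cons (desc_vals_le hW)]
      constructor
      · have h := wordMult_prepend_left hW (antitone_desc (vals true W))
          (μ := 0) antitone_const
        rw [greedy_true_one, (hg _).1, add_zero] at h
        rw [h, show unchained true ((true, x) :: W) = unchained false W by simp [unchained],
          (hg 0).2]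
        exact ih.1
      · intro e f
        cases e with
        | zero => simpa using (hg f).1
        | succ e => rw [greedy_true_succ, ih.2, sum_prepend]

/-- In a word with letters of only one kind, the pair of its values has multiplicity one and its
partial sums are the greedy sums. -/
theorem wordMult_of_count {W : Word} (hW : KindAntitone W)
    (h0 : count true W = 0 ∨ count false W = 0) :
    wordMult W (desc (vals true W)) (desc (vals false W)) = 1 ∧
      ∀ e f, greedy W e f = ∑ i ∈ Finset.range e, desc (vals true W) i +
        ∑ i ∈ Finset.range f, desc (vals false W) i := by
  have hd : ∀ k, count k W = 0 → ∀ e, ∑ i ∈ Finset.range e, desc (vals k W) i = 0 := by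
    intro k hk e
    exact Finset.sum_eq_zero fun i _ => desc_of_ge _ (by rw [card_vals, hk]; omega)
  rcases h0 with h0 | h0
  · have h := wordMult_of_count_false hW.flip (by simpa using h0)
    simp only [vals_flip, wordMult_flip, greedy_flip, Bool.not_true, Bool.not_false] at h
    exact ⟨h.1, fun e f => by rw [h.2 f e, hd true h0, zero_add]⟩
  · have h := wordMult_of_count_false hW h0
    exact ⟨h.1, fun e f => by rw [h.2, hd false h0, add_zero]⟩

/-! ### The pairs produced by the procedures -/

variable {α : Fin n → ℕ} {β : Fin m → ℕ} {s : ℝ}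

/-- The word of a list of indices. -/
abbrev listWord (α : Fin n → ℕ) (β : Fin m → ℕ) (L : List (Idx n m)) : Word :=
  wordOf Idx.kind (Idx.val α β) L

theorem listWord_cons (x : Idx n m) (L : List (Idx n m)) :
    listWord α β (x :: L) = (x.kind, x.val α β) :: listWord α β L := rfl

theorem count_listWord (e : Bool) (L : List (Idx n m)) :
    count e (listWord α β L) = Idx.cnt e L := by
  simp [count, wordOf, Idx.cnt, List.countP_map, Function.comp_def]

theorem vals_listWord (e : Bool) (L : List (Idx n m)) :
    vals e (listWord α β L) = Idx.part α β e L := by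
  simp [vals, wordOf, Idx.part, List.filter_map, Function.comp_def]

theorem listWord_rest (e : Bool) (L : List (Idx n m)) :
    listWord α β (Idx.rest e L) = unchained e (listWord α β L) := by
  induction L generalizing e with
  | nil => rfl
  | cons x L ih =>
    by_cases h : x.kind = e
    · simp [Idx.rest, h, listWord_cons, unchained, ih]
    · simp [Idx.rest, h, listWord_cons, unchained, ih]

theorem chainSum_eq_greedy (L : List (Idx n m)) :
    Idx.chainSum α β true L = greedy (listWord α β L) 1 0 ∧
      Idx.chainSum α β false L = greedy (listWord α β L) 0 1 := by
  induction L with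
  | nil => simp [Idx.chainSum, Idx.chain, wordOf]
  | cons x L ih =>
    simp only [Idx.chainSum] at ih
    rw [listWord_cons]
    cases h : x.kind <;> simp [Idx.chainSum, Idx.chain, h, ih]

theorem allowA_iff {A B : ℝ} {L : List (Idx n m)} (hL : L ≠ []) :
    Idx.AllowA α β A B L ↔
      (greedy (listWord α β L) 0 1 : ℝ) + B ≤ greedy (listWord α β L) 1 0 + A := by
  obtain ⟨x, L, rfl⟩ := List.exists_cons_of_ne_nil hL
  rw [listWord_cons]
  cases h : x.kind
  · simp only [Idx.AllowA, h, greedy_false_one, greedy_false_zero, zero_add, Bool.false_eq_true,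
      false_and, true_and, false_or]
    push_cast
    constructor <;> intro <;> linarith
  · simp only [Idx.AllowA, h, greedy_true_one, greedy_true_zero, zero_add, Bool.true_eq_false,
      false_and, true_and, or_false]
    push_cast
    constructor <;> intro <;> linarith

theorem allowB_iff {A B : ℝ} {L : List (Idx n m)} (hL : L ≠ []) :
    Idx.AllowB α β A B L ↔
      (greedy (listWord α β L) 1 0 : ℝ) + A ≤ greedy (listWord α β L) 0 1 + B := by
  obtain ⟨x, L, rfl⟩ := List.exists_cons_of_ne_nil hL
  rw [listWord_cons]
  cases h : x.kind
  · simp only [Idx.AllowB, h, greedy_false_one, greedy_false_zero, zero_add, Bool.false_eq_true,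
      false_and, true_and, false_or]
    push_cast
    constructor <;> intro <;> linarith
  · simp only [Idx.AllowB, h, greedy_true_one, greedy_true_zero, zero_add, Bool.true_eq_false,
      false_and, true_and, or_false]
    push_cast
    constructor <;> intro <;> linarith

/-- If an agent waiting for kind `true` is worth at least as much as one waiting for kind `false`,
up to the constants `A` and `B`, this remains so in the presence of further agents of the second
type. -/
theorem greedy_swap_le {W : Word} (hW : KindAntitone W) {A B : ℝ}
    (h : (greedy W 0 1 : ℝ) + B ≤ greedy W 1 0 + A) (f : ℕ) :
    (greedy W 0 (f + 1) : ℝ) + B ≤ greedy W 1 f + A := by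
  cases W with
  | nil => simpa using h
  | cons p W =>
    obtain ⟨k, x⟩ := p
    cases k
    · cases f with
      | zero => exact h
      | succ f =>
        have h1 := greedy_succ_right_le hW.le_head 1 f
        simp only [greedy_false_zero, greedy_false_succ, zero_add] at h h1 ⊢
        have h2 : (greedy W 1 (f + 1) : ℝ) ≤ x + greedy W (1 + 1) f := by exact_mod_cast h1
        push_cast at h ⊢
        linarith
    · simp only [greedy_true_one, greedy_true_zero] at h ⊢
      push_cast at h ⊢
      linarith

theorem greedy_swap_le' {W : Word} (hW : KindAntitone W) {A B : ℝ}
    (h : (greedy W 1 0 : ℝ) + A ≤ greedy W 0 1 + B) (e : ℕ) :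
    (greedy W (e + 1) 0 : ℝ) + A ≤ greedy W e 1 + B := by
  have h1 := greedy_swap_le hW.flip (A := B) (B := A) (by simpa only [greedy_flip] using h) e
  simpa only [greedy_flip] using h1

theorem desc_singleton_add_zeros (d : ℕ) (ν : Multiset ℕ) (c : ℕ) (h : desc ν 0 ≤ d) :
    desc ({d} + ν + Multiset.replicate c 0) = prepend d (desc ν) := by
  rw [desc_add_zeros, Multiset.singleton_add, desc_cons h]

theorem kindAntitone_rest {L : List (Idx n m)} (hW : KindAntitone (listWord α β L)) (e : Bool) :
    KindAntitone (listWord α β (Idx.rest e L)) := by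
  rw [listWord_rest]
  exact hW.unchained e

/-- Every pair produced by the procedures has multiplicity one. -/
theorem wordMult_of_inP {A B : ℝ} {L : List (Idx n m)} {ν μ : Multiset ℕ}
    (h : Idx.InP α β s A B L ν μ) (hW : KindAntitone (listWord α β L)) :
    wordMult (listWord α β L) (desc ν) (desc μ) = 1 := by
  induction h with
  | base A B L h =>
    rw [← vals_listWord, ← vals_listWord]
    exact (wordMult_of_count hW (by simpa only [count_listWord] using h)).1
  | stepA A B L ν μ ha hb h h' ih =>
    have ih := ih (kindAntitone_rest hW true)
    rw [listWord_rest] at ih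
    have h1 := sum_add_sum_le_greedy _ (hW.unchained true) _ _ (by rw [ih]; simp) 1 0
    have h2 := (greedy_unchained_le hW).1
    simp only [Finset.sum_range_one, Finset.sum_range_zero, add_zero] at h1
    rw [(chainSum_eq_greedy L).1, desc_singleton_add_zeros _ _ _ (h1.trans h2), desc_add_zeros,
      wordMult_prepend_left hW (antitone_desc _) (antitone_desc _), ih]
  | stepB A B L ν μ ha hb h h' ih =>
    have ih := ih (kindAntitone_rest hW false)
    rw [listWord_rest] at ih
    have h1 := sum_add_sum_le_greedy _ (hW.unchained false) _ _ (by rw [ih]; simp) 0 1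
    have h2 := (greedy_unchained_le hW).2
    simp only [Finset.sum_range_one, Finset.sum_range_zero, zero_add] at h1
    rw [(chainSum_eq_greedy L).2, desc_singleton_add_zeros _ _ _ (h1.trans h2), desc_add_zeros,
      wordMult_prepend_right hW (antitone_desc _) (antitone_desc _), ih]

/-- The first row of a pair produced from a word without its greedy chain is dominated by that
chain. -/
theorem desc_le_greedy_of_inP {A B : ℝ} {L : List (Idx n m)} {ν μ : Multiset ℕ}
    (hW : KindAntitone (listWord α β L)) :
    (Idx.InP α β s A B (Idx.rest true L) ν μ → desc ν 0 ≤ greedy (listWord α β L) 1 0) ∧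
      (Idx.InP α β s A B (Idx.rest false L) ν μ → desc μ 0 ≤ greedy (listWord α β L) 0 1) := by
  constructor <;> intro h
  · have h0 := wordMult_of_inP h (kindAntitone_rest hW true)
    rw [listWord_rest] at h0
    have h1 := sum_add_sum_le_greedy _ (hW.unchained true) _ _ (by rw [h0]; simp) 1 0
    simpa using h1.trans (greedy_unchained_le hW).1
  · have h0 := wordMult_of_inP h (kindAntitone_rest hW false)
    rw [listWord_rest] at h0
    have h1 := sum_add_sum_le_greedy _ (hW.unchained false) _ _ (by rw [h0]; simp) 0 1
    simpa using h1.trans (greedy_unchained_le hW).2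

theorem row_take_le (N : ℕ) (A s : ℝ) (f : ℕ → ℕ) {e : ℕ} (he : e ≤ N) :
    row e A s f ≤ row N A s f :=
  Multiset.map_le_map (Multiset.range_le.2 he)

theorem le_partialSum_symbol {N M : ℕ} (A B s : ℝ) (f g : ℕ → ℕ) {e₁ e₂ : ℕ} (h₁ : e₁ ≤ N)
    (h₂ : e₂ ≤ M) :
    ((∑ i ∈ Finset.range e₁, f i + ∑ i ∈ Finset.range e₂, g i : ℕ) : ℝ) + offset A B s e₁ e₂ ≤
      partialSum (e₁ + e₂) (symbol N M A B s f g) := by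
  have h := sum_le_partialSum (add_le_add (row_take_le N A s f h₁) (row_take_le M B s g h₂))
  simp only [Multiset.card_add, card_row, Multiset.sum_add] at h
  refine le_trans (le_of_eq ?_) h
  have hr : ∀ (e : ℕ) (C : ℝ) (f : ℕ → ℕ),
      (row e C s f).sum = ∑ i ∈ Finset.range e, ((f i : ℝ) + (C - s * i)) := fun _ _ _ => rfl
  rw [hr, hr, Finset.sum_add_distrib, Finset.sum_add_distrib, offset]
  push_cast
  ring

/-- The partial sums of the symbol of a pair produced by the procedures are at least the greedy
sums. -/
theorem greedy_le_partialSum (hs : 0 < s) {A B : ℝ} {L : List (Idx n m)} {ν μ : Multiset ℕ}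
    (h : Idx.InP α β s A B L ν μ) (hW : KindAntitone (listWord α β L)) {N M : ℕ}
    (hN : Idx.cnt true L ≤ N) (hM : Idx.cnt false L ≤ M) {e₁ e₂ : ℕ} (h₁ : e₁ ≤ N) (h₂ : e₂ ≤ M) :
    (greedy (listWord α β L) e₁ e₂ : ℝ) + offset A B s e₁ e₂ ≤
      partialSum (e₁ + e₂) (symbol N M A B s (desc ν) (desc μ)) := by
  induction h generalizing N M e₁ e₂ with
  | base A B L h =>
    rw [(wordMult_of_count hW (by simpa only [count_listWord] using h)).2, vals_listWord,
      vals_listWord]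
    exact le_partialSum_symbol A B s _ _ h₁ h₂
  | stepA A B L ν μ ha hb h h' ih =>
    have hn : L ≠ [] := by rintro rfl; simp [Idx.cnt] at ha
    obtain ⟨N, rfl⟩ : ∃ N', N = N' + 1 := ⟨N - 1, by omega⟩
    have c1 := Idx.rest_cnt true true L
    have c2 := Idx.rest_cnt false true L
    have c3 := Idx.chain_cnt_pos true L ha
    rw [(chainSum_eq_greedy L).1, desc_singleton_add_zeros _ _ _ ((desc_le_greedy_of_inP hW).1 h'),
      desc_add_zeros, symbol_prepend_left]
    have key : ∀ e₁ ≤ N, ∀ e₂ ≤ M,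
        (greedy (listWord α β L) (e₁ + 1) e₂ : ℝ) + offset A B s (e₁ + 1) e₂ ≤
          partialSum (e₁ + e₂ + 1) (((greedy (listWord α β L) 1 0 : ℕ) + A) ::ₘ
            symbol N M (A - s) B s (desc ν) (desc μ)) := by
      intro e₁ h₁ e₂ h₂
      have ih := ih (kindAntitone_rest hW true) (N := N) (M := M) (by omega) (by omega) h₁ h₂
      refine le_trans ?_ (add_partialSum_le _ (by rw [card_symbol]; omega))
      rw [greedy_succ_left, offset_succ_left, ← listWord_rest]
      push_cast
      linarith
    cases e₁ with
    | succ e₁ =>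
      rw [show e₁ + 1 + e₂ = e₁ + e₂ + 1 by ring]
      exact key e₁ (by omega) e₂ h₂
    | zero =>
      cases e₂ with
      | zero => simp [greedy_zero_zero, offset, partialSum]
      | succ e₂ =>
        refine le_trans ?_ (key 0 (by omega) e₂ (by omega)) |>.trans_eq ?_
        · have h3 := greedy_swap_le hW ((allowA_iff hn).1 h) e₂
          have h4 : 0 ≤ s * (e₂ : ℝ) := by positivity
          rw [zero_add]
          simp only [offset, Finset.sum_range_succ, Finset.sum_range_zero, Nat.cast_zero]
          linarith
        · congr 1
  | stepB A B L ν μ ha hb h h' ih =>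
    have hn : L ≠ [] := by rintro rfl; simp [Idx.cnt] at ha
    obtain ⟨M, rfl⟩ : ∃ M', M = M' + 1 := ⟨M - 1, by omega⟩
    have c1 := Idx.rest_cnt true false L
    have c2 := Idx.rest_cnt false false L
    have c3 := Idx.chain_cnt_pos false L hb
    rw [(chainSum_eq_greedy L).2, desc_singleton_add_zeros _ _ _ ((desc_le_greedy_of_inP hW).2 h'),
      desc_add_zeros, symbol_prepend_right]
    have key : ∀ e₁ ≤ N, ∀ e₂ ≤ M,
        (greedy (listWord α β L) e₁ (e₂ + 1) : ℝ) + offset A B s e₁ (e₂ + 1) ≤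
          partialSum (e₁ + e₂ + 1) (((greedy (listWord α β L) 0 1 : ℕ) + B) ::ₘ
            symbol N M A (B - s) s (desc ν) (desc μ)) := by
      intro e₁ h₁ e₂ h₂
      have ih := ih (kindAntitone_rest hW false) (N := N) (M := M) (by omega) (by omega) h₁ h₂
      refine le_trans ?_ (add_partialSum_le _ (by rw [card_symbol]; omega))
      rw [greedy_succ_right, offset_succ_right, ← listWord_rest]
      push_cast
      linarith
    cases e₂ with
    | succ e₂ => exact key e₁ h₁ e₂ (by omega)
    | zero =>
      cases e₁ with
      | zero => simp [greedy_zero_zero, offset, partialSum]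
      | succ e₁ =>
        refine le_trans ?_ (key e₁ (by omega) 0 (by omega)) |>.trans_eq ?_
        · have h3 := greedy_swap_le' hW ((allowB_iff hn).1 h) e₁
          have h4 : 0 ≤ s * (e₁ : ℝ) := by positivity
          rw [zero_add]
          simp only [offset, Finset.sum_range_succ, Finset.sum_range_zero, Nat.cast_zero]
          linarith
        · congr 1

/-- The symbol of a pair produced by the procedures dominates the symbols of all pairs that occur
in the word. -/
theorem partialSum_le_of_inP (hs : 0 < s) {A B : ℝ} {L : List (Idx n m)} {ν μ : Multiset ℕ}
    (h : Idx.InP α β s A B L ν μ) (hW : KindAntitone (listWord α β L)) {N M : ℕ}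
    (hN : Idx.cnt true L ≤ N) (hM : Idx.cnt false L ≤ M) {f g : ℕ → ℕ} (hf : Antitone f)
    (hg : Antitone g) (h0 : wordMult (listWord α β L) f g ≠ 0) {k : ℕ} (hk : k ≤ N + M) :
    partialSum k (symbol N M A B s f g) ≤
      partialSum k (symbol N M A B s (desc ν) (desc μ)) := by
  obtain ⟨e₁, h₁, e₂, h₂, rfl, hle⟩ := exists_partialSum_symbol_le hf hg A B hs hk
  refine hle.trans (le_trans ?_ (greedy_le_partialSum hs h hW hN hM h₁ h₂))
  have h1 : ((∑ i ∈ Finset.range e₁, f i + ∑ i ∈ Finset.range e₂, g i : ℕ) : ℝ) ≤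
      greedy (listWord α β L) e₁ e₂ := by
    exact_mod_cast sum_add_sum_le_greedy _ hW f g h0 e₁ e₂
  linarith

/-- All pairs produced by the procedures have the same symbol, as each of the symbols dominates the
others. -/
theorem symbol_eq_of_inP (hs : 0 < s) {A B : ℝ} {L : List (Idx n m)} {ν μ ν' μ' : Multiset ℕ}
    (h : Idx.InP α β s A B L ν μ) (h' : Idx.InP α β s A B L ν' μ')
    (hW : KindAntitone (listWord α β L)) {N M : ℕ} (hN : Idx.cnt true L ≤ N)
    (hM : Idx.cnt false L ≤ M) :
    symbol N M A B s (desc ν) (desc μ) = symbol N M A B s (desc ν') (desc μ') := by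
  refine eq_of_partialSum_eq (by simp) fun k hk => ?_
  rw [card_symbol] at hk
  exact le_antisymm
    (partialSum_le_of_inP hs h' hW hN hM (antitone_desc _) (antitone_desc _)
      (by rw [wordMult_of_inP h hW]; simp) hk)
    (partialSum_le_of_inP hs h hW hN hM (antitone_desc _) (antitone_desc _)
      (by rw [wordMult_of_inP h' hW]; simp) hk)

theorem map_range_prepend_eq {d k k' : ℕ} {f : ℕ → ℕ} (hk : k' + 1 ≤ k)
    (h0 : ∀ i, k' ≤ i → f i = 0) :
    {d} + (Multiset.range k').map f + Multiset.replicate (k - k' - 1) 0 =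
      (Multiset.range k).map (prepend d f) := by
  obtain ⟨c, rfl⟩ : ∃ c, k = k' + c + 1 := ⟨k - k' - 1, by omega⟩
  rw [map_range_prepend, add_assoc, show k' + c + 1 - k' - 1 = c by omega,
    ← map_range_add_zeros h0, Multiset.singleton_add]
  rfl

theorem map_range_add_zeros' {k k' : ℕ} {f : ℕ → ℕ} (hk : k' ≤ k) (h0 : ∀ i, k' ≤ i → f i = 0) :
    (Multiset.range k').map f + Multiset.replicate (k - k') 0 = (Multiset.range k).map f := by
  rw [← map_range_add_zeros h0, show k' + (k - k') = k by omega]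

theorem prepend_head_tail (f : ℕ → ℕ) : prepend (f 0) (fun i => f (i + 1)) = f := by
  funext i
  cases i <;> rfl

/-- A pair that occurs in the word and whose symbol is the maximal one is produced by the
procedures: its largest term tells which of them to start with. -/
theorem inP_of_symbol_eq (hs : 0 < s) (k : ℕ) : ∀ (A B : ℝ) (L : List (Idx n m)),
    Idx.cnt true L + Idx.cnt false L ≤ k → KindAntitone (listWord α β L) →
    ∀ N M : ℕ, Idx.cnt true L ≤ N → Idx.cnt false L ≤ M →
    ∀ f g : ℕ → ℕ, Antitone f → Antitone g → wordMult (listWord α β L) f g ≠ 0 →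
    ∀ ν μ, Idx.InP α β s A B L ν μ →
      symbol N M A B s f g = symbol N M A B s (desc ν) (desc μ) →
      Idx.InP α β s A B L ((Multiset.range (Idx.cnt true L)).map f)
        ((Multiset.range (Idx.cnt false L)).map g) := by
  induction k with
  | zero =>
    intro A B L hk hW N M hN hM f g hf hg h0 ν μ hP hsym
    have h := Idx.InP.base (α := α) (β := β) (s := s) A B L (Or.inl (by omega))
    have h1 : Idx.cnt true L = 0 := by omega
    have h2 : Idx.cnt false L = 0 := by omega
    have h3 := h.card_eq
    rw [h1, h2, Multiset.card_eq_zero, Multiset.card_eq_zero] at h3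
    rw [h3.1, h3.2] at h
    simpa [h1, h2] using h
  | succ k ih =>
    intro A B L hk hW N M hN hM f g hf hg h0 ν μ hP hsym
    have hsupp := wordMult_support _ _ _ h0
    rw [count_listWord, count_listWord] at hsupp
    by_cases hbase : Idx.cnt true L = 0 ∨ Idx.cnt false L = 0
    · have hb := Idx.InP.base (α := α) (β := β) (s := s) A B L hbase
      have hsym' := hsym.trans (symbol_eq_of_inP hs hP hb hW hN hM)
      have hc := hb.card_eq
      have hzero : ∀ (S : Multiset ℕ) (f : ℕ → ℕ), S.card = 0 → (∀ i, S.card ≤ i → f i = 0) →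
          desc S = f := by
        intro S f hS hf
        funext i
        rw [desc_of_ge S (by omega), hf i (by omega)]
      have hrow : ∀ (S : Multiset ℕ) (f : ℕ → ℕ) (K : ℕ) (C : ℝ), Antitone f → S.card ≤ K →
          (∀ i, S.card ≤ i → f i = 0) → row K C s f = row K C s (desc S) → desc S = f := by
        intro S f K C hf hK hf0 he
        funext i
        rcases lt_or_ge i K with hi | hi
        · exact (eq_of_row_eq hf (antitone_desc S) hs he i hi).symm
        · rw [desc_of_ge S (by omega), hf0 i (by omega)]
      rw [← hc.1] at hsupp hN
      rw [← hc.2] at hsupp hM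
      have hfg : desc (Idx.part α β true L) = f ∧ desc (Idx.part α β false L) = g := by
        rcases hbase with h | h
        · have e1 := hzero _ f (hc.1.trans h) hsupp.1
          rw [symbol, symbol, e1] at hsym'
          exact ⟨e1, hrow _ g M B hg hM hsupp.2 (add_left_cancel hsym')⟩
        · have e2 := hzero _ g (hc.2.trans h) hsupp.2
          rw [symbol, symbol, e2] at hsym'
          exact ⟨hrow _ f N A hf hN hsupp.1 (add_right_cancel hsym'), e2⟩
      rw [← hc.1, ← hc.2, ← hfg.1, ← hfg.2, map_desc, map_desc]
      exact hb
    · have ha : 1 ≤ Idx.cnt true L := by omega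
      have hb : 1 ≤ Idx.cnt false L := by omega
      have hn : L ≠ [] := by rintro rfl; simp [Idx.cnt] at ha
      have hbound := sum_add_sum_le_greedy _ hW f g h0
      obtain ⟨e₁, h₁, e₂, h₂, he, hle⟩ := exists_partialSum_symbol_le hf hg (N := N) (M := M) A B
        hs (k := 1) (by omega)
      have hgA := greedy_le_partialSum hs hP hW hN hM (e₁ := 1) (e₂ := 0) (by omega) (by omega)
      have hgB := greedy_le_partialSum hs hP hW hN hM (e₁ := 0) (e₂ := 1) (by omega) (by omega)
      rw [← hsym] at hgA hgB
      simp only [offset, Finset.sum_range_one, Finset.sum_range_zero, Nat.cast_zero, mul_zero,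
        sub_zero, add_zero, zero_add] at hgA hgB
      obtain ⟨rfl, rfl⟩ | ⟨rfl, rfl⟩ : (e₁ = 1 ∧ e₂ = 0) ∨ (e₁ = 0 ∧ e₂ = 1) := by omega
      · have hf0 : f 0 ≤ greedy (listWord α β L) 1 0 := by simpa using hbound 1 0
        simp only [offset, Finset.sum_range_one, Finset.sum_range_zero, Nat.cast_zero, mul_zero,
          sub_zero, add_zero] at hle
        have hf1 : greedy (listWord α β L) 1 0 = f 0 := by
          refine le_antisymm ?_ hf0
          have : (greedy (listWord α β L) 1 0 : ℝ) ≤ f 0 := by linarith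
          exact_mod_cast this
        have hallow : Idx.AllowA α β A B L := by
          rw [allowA_iff hn, hf1]
          linarith
        obtain ⟨N, rfl⟩ : ∃ N', N = N' + 1 := ⟨N - 1, by omega⟩
        have c1 := Idx.rest_cnt true true L
        have c2 := Idx.rest_cnt false true L
        have c3 := Idx.chain_cnt_pos true L ha
        have hf' : Antitone fun i => f (i + 1) := fun i j hij => hf (by omega)
        have hff := prepend_head_tail f
        rw [← hf1] at hff
        obtain ⟨ν₁, μ₁, hP₁⟩ := Idx.exists_inP α β s _ (A - s) B (Idx.rest true L) le_rfl
        have hstep := symbol_eq_of_inP hs hP (Idx.InP.stepA A B L ν₁ μ₁ ha hb hallow hP₁) hW hN hM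
        rw [(chainSum_eq_greedy L).1, desc_singleton_add_zeros _ _ _ ((desc_le_greedy_of_inP hW).1 hP₁),
          desc_add_zeros, symbol_prepend_left, ← hsym, ← hff, symbol_prepend_left,
          Multiset.cons_inj_right] at hstep
        rw [← hff, wordMult_prepend_left hW hf' hg, ← listWord_rest] at h0
        have hrec := ih (A - s) B (Idx.rest true L) (by omega) (kindAntitone_rest hW true) N M
          (by omega) (by omega) _ g hf' hg h0 ν₁ μ₁ hP₁ hstep
        have hsupp' := wordMult_support _ _ _ h0
        rw [count_listWord, count_listWord] at hsupp'
        have hfin := Idx.InP.stepA A B L _ _ ha hb hallow hrec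
        rwa [(chainSum_eq_greedy L).1, map_range_prepend_eq (by omega) hsupp'.1,
          map_range_add_zeros' (by omega) hsupp'.2, hff] at hfin
      · have hg0 : g 0 ≤ greedy (listWord α β L) 0 1 := by simpa using hbound 0 1
        simp only [offset, Finset.sum_range_one, Finset.sum_range_zero, Nat.cast_zero, mul_zero,
          sub_zero, zero_add] at hle
        have hg1 : greedy (listWord α β L) 0 1 = g 0 := by
          refine le_antisymm ?_ hg0
          have : (greedy (listWord α β L) 0 1 : ℝ) ≤ g 0 := by linarith
          exact_mod_cast this
        have hallow : Idx.AllowB α β A B L := by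
          rw [allowB_iff hn, hg1]
          linarith
        obtain ⟨M, rfl⟩ : ∃ M', M = M' + 1 := ⟨M - 1, by omega⟩
        have c1 := Idx.rest_cnt true false L
        have c2 := Idx.rest_cnt false false L
        have c3 := Idx.chain_cnt_pos false L hb
        have hg' : Antitone fun i => g (i + 1) := fun i j hij => hg (by omega)
        have hgg := prepend_head_tail g
        rw [← hg1] at hgg
        obtain ⟨ν₁, μ₁, hP₁⟩ := Idx.exists_inP α β s _ A (B - s) (Idx.rest false L) le_rfl
        have hstep := symbol_eq_of_inP hs hP (Idx.InP.stepB A B L ν₁ μ₁ ha hb hallow hP₁) hW hN hM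
        rw [(chainSum_eq_greedy L).2, desc_singleton_add_zeros _ _ _ ((desc_le_greedy_of_inP hW).2 hP₁),
          desc_add_zeros, symbol_prepend_right, ← hsym, ← hgg, symbol_prepend_right,
          Multiset.cons_inj_right] at hstep
        rw [← hgg, wordMult_prepend_right hW hf hg', ← listWord_rest] at h0
        have hrec := ih A (B - s) (Idx.rest false L) (by omega) (kindAntitone_rest hW false) N M
          (by omega) (by omega) f _ hf hg' h0 ν₁ μ₁ hP₁ hstep
        have hsupp' := wordMult_support _ _ _ h0
        rw [count_listWord, count_listWord] at hsupp'
        have hfin := Idx.InP.stepB A B L _ _ ha hb hallow hrec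
        rwa [(chainSum_eq_greedy L).2, map_range_prepend_eq (by omega) hsupp'.2,
          map_range_add_zeros' (by omega) hsupp'.1, hgg] at hfin

theorem kindAntitone_pairWord [LinearOrder (Idx n m)]
    (hI0 : ∀ i j : Fin n, (Idx.a i : Idx n m) < Idx.a j ↔ i < j)
    (hI1 : ∀ i j : Fin m, (Idx.b i : Idx n m) < Idx.b j ↔ i < j)
    (hα : Antitone α) (hβ : Antitone β) : KindAntitone (pairWord α β) := by
  unfold KindAntitone pairWord wordOf
  rw [List.pairwise_map]
  refine pairwise_letters.imp fun {p q} hpq hk => ?_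
  rcases p with i | i <;> rcases q with j | j
  · exact hα ((hI0 i j).1 hpq).le
  · simp [Idx.kind] at hk
  · simp [Idx.kind] at hk
  · exact hβ ((hI1 i j).1 hpq).le

end KindWord

open KindWord in
theorem proposition4p1 (n m : ℕ) [LinearOrder (Idx n m)]
    (hI0 : ∀ i j : Fin n, (Idx.a i : Idx n m) < Idx.a j ↔ i < j)
    (hI1 : ∀ i j : Fin m, (Idx.b i : Idx n m) < Idx.b j ↔ i < j)
    (α : Fin n → ℕ) (hα : Antitone α) (β : Fin m → ℕ) (hβ : Antitone β)
    (N M : ℕ) (hN : n ≤ N) (hM : m ≤ M) (A B s : ℝ) (hs : 0 < s)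
    (hA : s * ((N : ℝ) - 1) ≤ A) (hB : s * ((M : ℝ) - 1) ≤ B) :
    (∀ q ∈ PairSet A B s α β, pLambda N M A B s q.1 q.2 = pMax N M A B s α β) ∧
    ∀ (ν : Fin n → ℕ) (μ : Fin m → ℕ), Antitone ν → Antitone μ →
      ∑ i, ν i + ∑ j, μ j = ∑ i, α i + ∑ j, β j →
      (pairMult α β ν μ ≠ 0 → DomLE (pLambda N M A B s ν μ) (pMax N M A B s α β)) ∧
      (pLambda N M A B s ν μ = pMax N M A B s α β →
        (pairMult α β ν μ ≠ 0 ↔ (ν, μ) ∈ PairSet A B s α β)) ∧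
      ((ν, μ) ∈ PairSet A B s α β → pairMult α β ν μ = 1) := by
  have hW := kindAntitone_pairWord hI0 hI1 hα hβ
  have hcn : Idx.cnt true (letters n m) = n := Idx.cnt_sort_univ.1
  have hcm : Idx.cnt false (letters n m) = m := Idx.cnt_sort_univ.2
  have hN' : Idx.cnt true (letters n m) ≤ N := hcn.trans_le hN
  have hM' : Idx.cnt false (letters n m) ≤ M := hcm.trans_le hM
  set q₀ := (PairSet_nonempty A B s α β).some with hq₀
  obtain ⟨ha₀, hb₀, hP₀⟩ : q₀ ∈ PairSet A B s α β := (PairSet_nonempty A B s α β).some_mem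
  have hmax : pMax N M A B s α β =
      symbol N M A B s (desc (terms q₀.1)) (desc (terms q₀.2)) := by
    rw [desc_terms ha₀, desc_terms hb₀]
    exact pLambda_eq_symbol N M A B s q₀.1 q₀.2
  have hone : ∀ (ν : Fin n → ℕ) (μ : Fin m → ℕ), (ν, μ) ∈ PairSet A B s α β →
      pairMult α β ν μ = 1 := by
    rintro ν μ ⟨hν, hμ, hP⟩
    have h := wordMult_of_inP hP hW
    rwa [desc_terms hν, desc_terms hμ, ← pairMult_eq_wordMult hI0 hI1 α β hν hμ] at h
  refine ⟨?_, fun ν μ hν hμ _ => ⟨fun h0 => ?_, fun heq => ⟨fun h0 => ?_, fun hP => ?_⟩,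
    hone ν μ⟩⟩
  · rintro q ⟨hν, hμ, hP⟩
    rw [hmax, pLambda_eq_symbol, ← symbol_eq_of_inP hs hP hP₀ hW hN' hM', desc_terms hν,
      desc_terms hμ]
  · rw [pairMult_eq_wordMult hI0 hI1 α β hν hμ] at h0
    rw [hmax, pLambda_eq_symbol]
    refine ⟨by simp, fun k _ hk => ?_⟩
    exact partialSum_le_of_inP hs hP₀ hW hN' hM' (antitone_pad hν) (antitone_pad hμ) h0
      (by simpa using hk)
  · rw [pairMult_eq_wordMult hI0 hI1 α β hν hμ] at h0
    rw [hmax, pLambda_eq_symbol] at heq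
    have h := inP_of_symbol_eq hs _ A B (letters n m) le_rfl hW N M hN' hM' _ _ (antitone_pad hν)
      (antitone_pad hμ) h0 _ _ hP₀ heq
    rw [hcn, hcm, ← terms_eq_map_pad, ← terms_eq_map_pad] at h
    exact ⟨hν, hμ, h⟩
  · rw [hone ν μ hP]
    exact one_ne_zero
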